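/- Let $1\le N_T\le N_R$ be integers, $N=N_R-N_T+1$, $\Gamma_s>0$ and $K\ge 0$. Let $$H=\sqrt{\tfrac{K}{K+1}}\,H_{d,n}+\sqrt{\tfrac{1}{K+1}}\,H_{r,n}\in\mathbb C^{N_R\times N_T},$$ where $H_{d,n}$ is a deterministic matrix with Frobenius norm $\|H_{d,n}\|^2=N_TN_R$, and the conjugate-transposed rows of the random matrix $H_{r,n}$ are independent with the circularly symmetric complex Gaussian law $\mathcal{CN}(0,R_T)$, $R_T$ being a Hermitian positive definite matrix with unit diagonal. Put $H_d=\sqrt{K/(K+1)}\,H_{d,n}$, with columns $h_{d,j}$, and $R_{T,K}=R_T/(K+1)$. Let stream $k\in\{1,\dots,N_T\}$ be the intended one (the choice $k=1$ being typical) and assume Rician--Rayleigh fading: $h_{d,j}=0$ for all $j\neq k$. The zero-forcing SNR of stream $k$ is $\gamma=\Gamma_s/[(H^{\mathcal H}H)^{-1}]_{k,k}$. Put $$\Gamma=\frac{\Gamma_s}{[R_{T,K}^{-1}]_{k,k}},\qquad a=[R_{T,K}^{-1}]_{k,k}\,\|h_{d,k}\|^2,\qquad A_n(a)=\frac{(N)_n}{(N_R)_n}\frac{a^n}{n!},$$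 where $(x)_n=x(x+1)\cdots(x+n-1)$. Then: 1. $\Gamma=\Gamma_s/((K+1)[R_T^{-1}]_{k,k})>0$ and $a=K N_R N_T [R_T^{-1}]_{k,k}$. 2. For every real $s<1/\Gamma$, $e^{s\gamma}$ is integrable and $$\mathbb E\{e^{s\gamma}\}=\sum_{n=0}^\infty A_n(a)\sum_{m=0}^n\binom nm(-1)^m\frac{1}{(1-s\Gamma)^{N+n-m}},$$ where the series over $n$ converges absolutely. 3. The distribution of $\gamma$ has a density, equal to $0$ for $t<0$ and, for $t\ge 0$, to the infinite signed linear combination of gamma densities $$p_\gamma(t)=\sum_{n=0}^\infty A_n(a)\sum_{m=0}^n\binom nm(-1)^m p_{m,n}(t),\qquad p_{m,n}(t)=\frac{t^{N+n-m-1}e^{-t/\Gamma}}{(N+n-m-1)!\,\Gamma^{N+n-m}},$$ where the series over $n$ converges absolutely for every $t\ge0$ and its sum is nonnegative; $p_{m,n}$ is the density of the gamma distribution $\mathrm{Gamma}(N+n-m,\Gamma)$ with shape $N+n-m$ and scale $\Gamma$. 4. If $K=0$ (Rayleigh--Rayleigh fading) then $a=0$. If $a=0$, then $\mathbb E\{e^{s\gamma}\}=(1-s\Gamma)^{-N}$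 for $s<1/\Gamma$, the series in 3 reduces to $p_{0,0}(t)=t^{N-1}e^{-t/\Gamma}/((N-1)!\,\Gamma^N)$, and $\gamma\sim\mathrm{Gamma}(N,\Gamma)$. -/

import Mathlib

open MeasureTheory ProbabilityTheory Matrix
open scoped ComplexOrder

noncomputable section

/-- `X` is a circularly symmetric complex Gaussian random vector with mean `m` and covariance
matrix `S` (the law `CN(m, S)`), that is, for every `u`,
`E exp(i Re(uᴴ X)) = exp(i Re(uᴴ m) - uᴴ S u / 4)`.
(`charFun` uses the real inner product `Re(uᴴ x)` of `ℂⁿ`.) -/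
def IsComplexGaussian {Ω : Type*} [MeasurableSpace Ω] (P : Measure Ω) {n : ℕ}
    (X : Ω → EuclideanSpace ℂ (Fin n)) (m : EuclideanSpace ℂ (Fin n))
    (S : Matrix (Fin n) (Fin n) ℂ) : Prop :=
  AEMeasurable X P ∧
    ∀ u : EuclideanSpace ℂ (Fin n),
      charFun (P.map X) u =
        Complex.exp (((inner ℝ m u : ℝ) : ℂ) * Complex.I
          - (star u.ofLp ⬝ᵥ (S *ᵥ u.ofLp)) / 4)

/-- The conjugate transpose of row `i` of a matrix, as a column vector. -/
def conjRow {NR NT : ℕ} (A : Matrix (Fin NR) (Fin NT) ℂ) (i : Fin NR) :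
    EuclideanSpace ℂ (Fin NT) :=
  WithLp.toLp 2 (fun j => star (A i j))

/-- The deterministic component `H_d = √(K/(K+1)) H_{d,n}` of the channel matrix. -/
def channelMean {NR NT : ℕ} (K : ℝ) (Hdn : Matrix (Fin NR) (Fin NT) ℂ) :
    Matrix (Fin NR) (Fin NT) ℂ :=
  ((Real.sqrt (K / (K + 1)) : ℝ) : ℂ) • Hdn

/-- The channel matrix `H = √(K/(K+1)) H_{d,n} + √(1/(K+1)) H_{r,n}`. -/
def channel {NR NT : ℕ} (K : ℝ) (Hdn Hrn : Matrix (Fin NR) (Fin NT) ℂ) :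
    Matrix (Fin NR) (Fin NT) ℂ :=
  channelMean K Hdn + ((Real.sqrt (1 / (K + 1)) : ℝ) : ℂ) • Hrn

/-- The transmit covariance matrix `R_{T,K} = R_T / (K+1)` of the random component. -/
def transmitCov {NT : ℕ} (K : ℝ) (RT : Matrix (Fin NT) (Fin NT) ℂ) :
    Matrix (Fin NT) (Fin NT) ℂ :=
  ((1 / (K + 1) : ℝ) : ℂ) • RT

/-- The zero-forcing SNR `Γ_s / [(Hᴴ H)⁻¹]_{k,k}` of stream `k`. The diagonal entry is real. -/
def zfSNR {NR NT : ℕ} (Γs : ℝ) (H : Matrix (Fin NR) (Fin NT) ℂ) (k : Fin NT) : ℝ :=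
  Γs / ((Hᴴ * H)⁻¹ k k).re

/-- The scale parameter `Γ_k = Γ_s / [R_{T,K}⁻¹]_{k,k}`. The diagonal entry is real. -/
def snrScale {NT : ℕ} (Γs K : ℝ) (RT : Matrix (Fin NT) (Fin NT) ℂ) (k : Fin NT) : ℝ :=
  Γs / ((transmitCov K RT)⁻¹ k k).re

/-- The parameter `a = [R_{T,K}⁻¹]_{k,k} ‖h_{d,k}‖²`, where `h_{d,k}` is column `k` of `H_d`. -/
def snrMeanParam {NR NT : ℕ} (K : ℝ) (RT : Matrix (Fin NT) (Fin NT) ℂ)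
    (Hdn : Matrix (Fin NR) (Fin NT) ℂ) (k : Fin NT) : ℝ :=
  ((transmitCov K RT)⁻¹ k k).re * ∑ i, ‖channelMean K Hdn i k‖ ^ 2

/-- The coefficient `A_n(a) = (N)_n a^n / ((N_R)_n n!)`, with `(x)_n` the rising factorial. -/
def seriesCoeff (N NR : ℕ) (a : ℝ) (n : ℕ) : ℝ :=
  (ascPochhammer ℝ n).eval (N : ℝ) / (ascPochhammer ℝ n).eval (NR : ℝ)
    * (a ^ n / (n.factorial : ℝ))

/-- Term `n` of the density series: `A_n(a) ∑_{m=0}^n C(n,m) (-1)^m p_{m,n}(t)`, where `p_{m,n}` is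
the density of the gamma distribution with shape `N + n - m` and scale `Γ` (rate `1/Γ`). -/
def pdfTerm (N NR : ℕ) (a Γ t : ℝ) (n : ℕ) : ℝ :=
  seriesCoeff N NR a n *
    ∑ m ∈ Finset.range (n + 1),
      (n.choose m : ℝ) * (-1) ^ m * gammaPDFReal ((N + n - m : ℕ) : ℝ) (1 / Γ) t

/-- Term `n` of the moment generating function series:
`A_n(a) ∑_{m=0}^n C(n,m) (-1)^m / (1 - sΓ)^(N + n - m)`. -/
def mgfTerm (N NR : ℕ) (a Γ s : ℝ) (n : ℕ) : ℝ :=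
  seriesCoeff N NR a n *
    ∑ m ∈ Finset.range (n + 1),
      (n.choose m : ℝ) * (-1) ^ m * (1 / (1 - s * Γ) ^ (N + n - m))

end

/-! The reciprocal of `[(HᴴH)⁻¹]_{k,k}` is the squared distance from column k of H to the span of
the other columns. `exists_whitening` gives V with `Vᴴ R_{T,K} V = 1` whose row k is ρ times the
k-th unit vector, ρ² = `[R_{T,K}⁻¹]_{k,k}`. Passing from H to HV divides that entry by ρ² and makes
the columns independent standard Gaussian, with mean zero except column k, whose mean h satisfies
‖h‖² = a. So γ is Γ times the squared distance from h + x to the span of independent Gaussian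
vectors Y (`exists_gaussianPair_representation`).

Almost surely Y is linearly independent, and the distance is then ‖T(h + x)‖ for a coisometry T onto
`ℂᴺ`. Given Y, γ/Γ is noncentral chi-square with random noncentrality λ = ‖Th‖² in [0, a]. Its
transform at σ is `(1 - σ)⁻ᴺ exp(λσ/(1 - σ))`, and its density is a Poisson(λ) mixture of gamma
densities.

The coefficients are moments: A_q(a) = E[λ^q]/q!. By unitary invariance E[λ^q] = C ‖h‖^{2q}, and
averaging over a Gaussian h in both orders gives C = (N)_q/(N_R)_q (`lintegral_residualTo_pow`).
Expanding the exponential in λ, with σ/(1 - σ) = -1 + 1/(1 - σ), gives the transform series. The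
signed density series is likewise the average over λ of nonnegative densities. It has the transform
of γ for every s < 1/Γ, so `measure_ext_of_mgf_eqOn_Iio` identifies the law. -/

/-- Finite measures on `ℝ` whose moment generating functions exist and agree on a left-infinite
interval around `0` are equal. -/
theorem measure_ext_of_mgf_eqOn_Iio {μ ν : Measure ℝ} [IsFiniteMeasure μ] [IsFiniteMeasure ν]
    {c : ℝ} (hc : 0 < c)
    (hμ : ∀ s < c, Integrable (fun x => Real.exp (s * x)) μ)
    (hν : ∀ s < c, Integrable (fun x => Real.exp (s * x)) ν)
    (h : ∀ s < c, mgf id μ s = mgf id ν s) : μ = ν := by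
  have aux : ∀ ρ : Measure ℝ, (∀ s < c, Integrable (fun x => Real.exp (s * x)) ρ) →
      AnalyticOnNhd ℂ (complexMGF id ρ) {z | z.re ∈ Set.Iio c} := by
    intro ρ hρ
    refine (analyticOnNhd_complexMGF (X := id) (μ := ρ)).mono ?_
    intro z hz
    exact interior_maximal (fun s hs => hρ s hs) isOpen_Iio hz
  -- Identity theorem on the half-plane `re z < c`: agreement on reals accumulating at 0 suffices.
  -- Since 0 < c, the half-plane contains the imaginary axis, where the transforms are
  -- characteristic functions.
  have heq : Set.EqOn (complexMGF id μ) (complexMGF id ν) {z | z.re ∈ Set.Iio c} := by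
    refine AnalyticOnNhd.eqOn_of_preconnected_of_frequently_eq (aux μ hμ) (aux ν hν)
      ((convex_Iio c).linear_preimage Complex.reLm).isPreconnected
      (z₀ := ((0 : ℝ) : ℂ)) (by simpa using hc) ?_
    have h_real : ∃ᶠ (x : ℝ) in nhdsWithin 0 {0}ᶜ, complexMGF id μ x = complexMGF id ν x := by
      refine Filter.Eventually.frequently ?_
      filter_upwards [nhdsWithin_le_nhds (Iio_mem_nhds hc)] with y hy
      rw [complexMGF_ofReal, complexMGF_ofReal, h y hy]
    rw [Filter.frequently_iff_seq_forall] at h_real ⊢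
    obtain ⟨xs, hx_tendsto, hx_eq⟩ := h_real
    refine ⟨fun n => xs n, ?_, fun n => ?_⟩
    · rw [tendsto_nhdsWithin_iff] at hx_tendsto ⊢
      constructor
      · rw [Filter.tendsto_ofReal_iff]
        exact hx_tendsto.1
      · simpa using hx_tendsto.2
    · simp [hx_eq]
  refine Measure.ext_of_charFun (funext fun t => ?_)
  rw [← complexMGF_id_mul_I, ← complexMGF_id_mul_I]
  exact heq (by simpa using hc)

/-! ### Gamma densities and one-dimensional Gaussian integrals. -/

/-- Exponential tilting of a gamma density. -/
theorem exp_mul_gammaPDFReal {a r s : ℝ} (hr : 0 < r) (hs : s < r) (t : ℝ) :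
    Real.exp (s * t) * gammaPDFReal a r t = (r / (r - s)) ^ a * gammaPDFReal a (r - s) t := by
  unfold gammaPDFReal
  split_ifs
  · have h1 : 0 < r - s := by linarith
    have h2 : (r - s) ^ a ≠ 0 := (Real.rpow_pos_of_pos h1 a).ne'
    have h3 : Real.exp (-((r - s) * t)) = Real.exp (s * t) * Real.exp (-(r * t)) := by
      rw [← Real.exp_add]; ring_nf
    rw [Real.div_rpow hr.le h1.le, h3]
    field_simp
  · simp

theorem integrable_gammaPDFReal {a r : ℝ} (ha : 0 < a) (hr : 0 < r) :
    Integrable (gammaPDFReal a r) := by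
  refine ⟨(measurable_gammaPDFReal a r).aestronglyMeasurable, ?_⟩
  rw [hasFiniteIntegral_iff_ofReal (ae_of_all _ (gammaPDFReal_nonneg ha hr))]
  have := lintegral_gammaPDF_eq_one ha hr
  unfold gammaPDF at this
  rw [this]
  exact ENNReal.one_lt_top

theorem integral_gammaPDFReal {a r : ℝ} (ha : 0 < a) (hr : 0 < r) :
    ∫ t, gammaPDFReal a r t = 1 := by
  rw [integral_eq_lintegral_of_nonneg_ae (ae_of_all _ (gammaPDFReal_nonneg ha hr))
    (measurable_gammaPDFReal a r).aestronglyMeasurable]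
  have := lintegral_gammaPDF_eq_one ha hr
  unfold gammaPDF at this
  rw [this]
  rfl

theorem integrable_exp_mul_gammaPDFReal {a r s : ℝ} (ha : 0 < a) (hr : 0 < r) (hs : s < r) :
    Integrable (fun t => Real.exp (s * t) * gammaPDFReal a r t) := by
  simp_rw [exp_mul_gammaPDFReal hr hs]
  exact (integrable_gammaPDFReal ha (by linarith)).const_mul _

theorem integral_exp_mul_gammaPDFReal {n : ℕ} (hn : 0 < n) {θ s : ℝ} (hθ : 0 < θ)
    (hs : s < 1 / θ) :
    ∫ t, Real.exp (s * t) * gammaPDFReal (n : ℝ) (1 / θ) t = 1 / (1 - s * θ) ^ n := by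
  have hr : 0 < 1 / θ := by positivity
  simp_rw [exp_mul_gammaPDFReal hr hs]
  rw [integral_const_mul, integral_gammaPDFReal (by exact_mod_cast hn) (by linarith), mul_one,
    Real.rpow_natCast, one_div, one_div, ← inv_pow]
  congr 1
  have : 0 < θ⁻¹ - s := by rw [← one_div]; linarith
  have h2 : 1 - s * θ = (θ⁻¹ - s) * θ := by field_simp
  rw [h2, mul_inv, div_eq_mul_inv, mul_comm]

/-- Multiplying a gamma density by a power shifts the shape parameter. -/
theorem pow_mul_gammaPDFReal {N : ℕ} (hN : 0 < N) (n : ℕ) (t : ℝ) :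
    t ^ n * gammaPDFReal (N : ℝ) 1 t =
      (ascPochhammer ℝ n).eval (N : ℝ) * gammaPDFReal ((N + n : ℕ) : ℝ) 1 t := by
  unfold gammaPDFReal
  split_ifs with ht
  · obtain ⟨M, rfl⟩ : ∃ M, N = M + 1 := ⟨N - 1, by omega⟩
    have e1 : ((M + 1 : ℕ) : ℝ) - 1 = (M : ℕ) := by push_cast; ring
    have e2 : ((M + 1 + n : ℕ) : ℝ) - 1 = ((M + n : ℕ) : ℝ) := by push_cast; ring
    have e3 : ((M + 1 + n : ℕ) : ℝ) = ((M + n : ℕ) : ℝ) + 1 := by push_cast; ring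
    rw [e1, e2, Real.rpow_natCast, Real.rpow_natCast, Real.rpow_natCast, Real.rpow_natCast, e3, Real.Gamma_nat_eq_factorial]
    have h := factorial_mul_ascPochhammer ℝ M n
    have h0 : (M.factorial : ℝ) ≠ 0 := by positivity
    have h1 : ((M + n).factorial : ℝ) ≠ 0 := by positivity
    have e4 : ((M + 1 : ℕ) : ℝ) = (M : ℝ) + 1 := by push_cast; ring
    rw [e4, Real.Gamma_nat_eq_factorial, one_pow, one_pow, ← h]
    rw [← h] at h1
    have h2 := right_ne_zero_of_mul h1
    field_simp
    ring
  · simp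

/-- `(rt)^M / M!` is a single term of the series of `exp(rt)`. The bound is uniform in the shape,
which is what summing the density series requires. -/
theorem gammaPDFReal_nat_le {n : ℕ} (hn : 0 < n) {r : ℝ} (hr : 0 < r) (t : ℝ) :
    gammaPDFReal (n : ℝ) r t ≤ r := by
  unfold gammaPDFReal
  split_ifs with ht
  · obtain ⟨M, rfl⟩ : ∃ M, n = M + 1 := ⟨n - 1, by omega⟩
    have e1 : ((M + 1 : ℕ) : ℝ) - 1 = (M : ℕ) := by push_cast; ring
    have e3 : ((M + 1 : ℕ) : ℝ) = (M : ℝ) + 1 := by push_cast; ring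
    rw [e1, Real.rpow_natCast, Real.rpow_natCast, e3, Real.Gamma_nat_eq_factorial]
    have h := Real.pow_div_factorial_le_exp (r * t) (by positivity) M
    calc r ^ (M + 1) / (M.factorial : ℝ) * t ^ M * Real.exp (-(r * t))
        = r * ((r * t) ^ M / (M.factorial : ℝ)) * Real.exp (-(r * t)) := by ring
      _ ≤ r * Real.exp (r * t) * Real.exp (-(r * t)) := by gcongr
      _ = r := by rw [mul_assoc, ← Real.exp_add]; simp
  · exact hr.le

/-- Completing the square: the tilted density is again Gaussian up to a constant, and that constant
is the exponential moment. -/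
theorem exp_mul_gaussianPDFReal {s : ℝ} (hs : s < 1) (b x : ℝ) :
    Real.exp (s * (b + (Real.sqrt 2)⁻¹ * x) ^ 2) * gaussianPDFReal 0 1 x =
      ((Real.sqrt (1 - s))⁻¹ * Real.exp (s * b ^ 2 / (1 - s))) *
        gaussianPDFReal (Real.sqrt 2 * s * b / (1 - s)) (1 / (1 - s)).toNNReal x := by
  have h1 : 0 < 1 - s := by linarith
  have h2 : (Real.sqrt 2) ^ 2 = 2 := Real.sq_sqrt (by norm_num)
  have h3 : Real.sqrt 2 ≠ 0 := by positivity
  unfold gaussianPDFReal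
  rw [Real.coe_toNNReal _ (by positivity)]
  have h4 : Real.sqrt (2 * Real.pi * (1 / (1 - s))) =
      Real.sqrt (2 * Real.pi) * (Real.sqrt (1 - s))⁻¹ := by
    rw [Real.sqrt_mul (by positivity), one_div, Real.sqrt_inv]
  have h5 : Real.sqrt (1 - s) ≠ 0 := by positivity
  have h6 : Real.sqrt (2 * Real.pi) ≠ 0 := by positivity
  have h7 : s * (b + (Real.sqrt 2)⁻¹ * x) ^ 2 + -(x - 0) ^ 2 / (2 * (1 : NNReal)) =
      s * b ^ 2 / (1 - s) +
        -(x - Real.sqrt 2 * s * b / (1 - s)) ^ 2 / (2 * (1 / (1 - s))) := by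
    have h8 : (Real.sqrt 2)⁻¹ = Real.sqrt 2 / 2 := by field_simp; exact h2.symm
    rw [h8]
    push_cast
    field_simp
    ring_nf
    rw [h2]
    ring
  rw [h4, mul_left_comm, ← Real.exp_add, h7, Real.exp_add]
  simp only [NNReal.coe_one, mul_one, mul_inv, inv_inv]
  field_simp

theorem lintegral_exp_sq_gaussianReal {s : ℝ} (hs : s < 1) (b : ℝ) :
    ∫⁻ x, ENNReal.ofReal (Real.exp (s * (b + (Real.sqrt 2)⁻¹ * x) ^ 2)) ∂(gaussianReal 0 1) =
      ENNReal.ofReal ((Real.sqrt (1 - s))⁻¹ * Real.exp (s * b ^ 2 / (1 - s))) := by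
  have h1 : 0 < 1 - s := by linarith
  have hv : (1 / (1 - s)).toNNReal ≠ 0 := by
    rw [Ne, Real.toNNReal_eq_zero, not_le]; positivity
  rw [gaussianReal_of_var_ne_zero 0 one_ne_zero,
    lintegral_withDensity_eq_lintegral_mul _ (measurable_gaussianPDF 0 1) (by fun_prop)]
  simp only [Pi.mul_apply, gaussianPDF]
  simp_rw [mul_comm (ENNReal.ofReal (gaussianPDFReal 0 1 _)), ← ENNReal.ofReal_mul
    (Real.exp_nonneg _), exp_mul_gaussianPDFReal hs]
  simp_rw [ENNReal.ofReal_mul (show 0 ≤ (Real.sqrt (1 - s))⁻¹ * Real.exp (s * b ^ 2 / (1 - s))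
    by positivity)]
  rw [lintegral_const_mul _ (by fun_prop), lintegral_gaussianPDFReal_eq_one _ hv, mul_one]

theorem lintegral_pi_prod_eq_prod {ι : Type*} [Fintype ι] {α : ι → Type*}
    [∀ i, MeasurableSpace (α i)] (μ : ∀ i, Measure (α i)) [∀ i, IsProbabilityMeasure (μ i)]
    {f : ∀ i, α i → ENNReal} (hf : ∀ i, Measurable (f i)) :
    ∫⁻ x, ∏ i, f i (x i) ∂(Measure.pi μ) = ∏ i, ∫⁻ x, f i x ∂(μ i) := by
  have hind : iIndepFun (fun i (x : ∀ i, α i) => f i (x i)) (Measure.pi μ) :=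
    iIndepFun_pi (X := f) (fun i => (hf i).aemeasurable)
  rw [lintegral_prod_eq_prod_lintegral_of_indepFun Finset.univ _ hind
    (fun i => (hf i).comp (measurable_pi_apply i))]
  refine Finset.prod_congr rfl fun i _ => ?_
  exact (measurePreserving_eval μ i).lintegral_comp (hf i)

/-! ### The Gaussian measure with variance 1/2 per real direction. -/

section HalfGaussian

variable (E : Type*) [NormedAddCommGroup E] [InnerProductSpace ℝ E] [FiniteDimensional ℝ E]
  [MeasurableSpace E] [BorelSpace E]

/-- The centred Gaussian measure with variance `1/2` in every direction; on a complex space this is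
the circularly symmetric law `CN(0, I)`. -/
noncomputable def halfGaussian : Measure E :=
  (stdGaussian E).map (fun x => (Real.sqrt 2)⁻¹ • x)

instance isProbabilityMeasure_halfGaussian : IsProbabilityMeasure (halfGaussian E) :=
  Measure.isProbabilityMeasure_map (by fun_prop)

variable {E}

theorem charFun_halfGaussian (t : E) :
    charFun (halfGaussian E) t = Complex.exp (-(‖t‖ ^ 2 : ℝ) / 4) := by
  rw [halfGaussian, charFun_map_smul, charFun_stdGaussian, norm_smul, norm_inv, Real.norm_eq_abs,
    abs_of_pos (by positivity : 0 < Real.sqrt 2)]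
  congr 1
  have h2 : (Real.sqrt 2) ^ 2 = 2 := Real.sq_sqrt (by norm_num)
  have : ((Real.sqrt 2)⁻¹ * ‖t‖) ^ 2 = ‖t‖ ^ 2 / 2 := by
    rw [mul_pow, inv_pow, h2]; ring
  rw [← Complex.ofReal_pow, this]
  push_cast
  ring

theorem halfGaussian_eq_of_charFun {μ : Measure E} [IsFiniteMeasure μ]
    (h : ∀ t, charFun μ t = Complex.exp (-(‖t‖ ^ 2 : ℝ) / 4)) : μ = halfGaussian E :=
  Measure.ext_of_charFun (funext fun t => (h t).trans (charFun_halfGaussian t).symm)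

/-- The image of the Gaussian measure under the adjoint of an isometry is Gaussian. -/
theorem halfGaussian_map_of_isometry_adjoint {F : Type*} [NormedAddCommGroup F]
    [InnerProductSpace ℝ F] [FiniteDimensional ℝ F] [MeasurableSpace F] [BorelSpace F]
    (T : E → F) (hT : Measurable T) (S : F → E) (hS : ∀ t, ‖S t‖ = ‖t‖)
    (hST : ∀ x t, inner ℝ (T x) t = inner ℝ x (S t)) :
    (halfGaussian E).map T = halfGaussian F := by
  have : IsProbabilityMeasure ((halfGaussian E).map T) :=
    Measure.isProbabilityMeasure_map hT.aemeasurable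
  refine halfGaussian_eq_of_charFun fun t => ?_
  rw [charFun_apply, integral_map hT.aemeasurable (by fun_prop)]
  simp_rw [hST]
  rw [← charFun_apply, charFun_halfGaussian, hS]

/-- In an orthonormal basis the integrand factors into one-dimensional integrals, one per real
dimension. -/
theorem lintegral_exp_norm_sq_halfGaussian {s : ℝ} (hs : s < 1) (h : E) :
    ∫⁻ x, ENNReal.ofReal (Real.exp (s * ‖h + x‖ ^ 2)) ∂(halfGaussian E) =
      ENNReal.ofReal ((Real.sqrt (1 - s))⁻¹ ^ (Module.finrank ℝ E) *
        Real.exp (s * ‖h‖ ^ 2 / (1 - s))) := by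
  set b := stdOrthonormalBasis ℝ E
  have hnorm : ∀ x : Fin (Module.finrank ℝ E) → ℝ,
      ‖h + (Real.sqrt 2)⁻¹ • ∑ i, x i • b i‖ ^ 2 =
        ∑ i, (b.repr h i + (Real.sqrt 2)⁻¹ * x i) ^ 2 := by
    intro x
    rw [← b.repr.norm_map, EuclideanSpace.real_norm_sq_eq]
    refine Finset.sum_congr rfl fun i _ => ?_
    have : b.repr (∑ i, x i • b i) i = x i := by
      simp [map_sum, OrthonormalBasis.repr_self, Pi.single_apply]
    rw [map_add, map_smul, PiLp.add_apply, PiLp.smul_apply, this, smul_eq_mul]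
  rw [halfGaussian, lintegral_map (by fun_prop) (by fun_prop), stdGaussian,
    lintegral_map (by fun_prop) (by fun_prop)]
  have hprod : ∀ x : Fin (Module.finrank ℝ E) → ℝ,
      ENNReal.ofReal (Real.exp (s * ‖h + (Real.sqrt 2)⁻¹ • ∑ i, x i • b i‖ ^ 2)) =
        ∏ i, ENNReal.ofReal (Real.exp (s * (b.repr h i + (Real.sqrt 2)⁻¹ * x i) ^ 2)) := by
    intro x
    rw [hnorm, Finset.mul_sum, Real.exp_sum, ENNReal.ofReal_prod_of_nonneg]
    exact fun _ _ => Real.exp_nonneg _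
  simp_rw [b] at hprod
  simp_rw [hprod]
  rw [lintegral_pi_prod_eq_prod (fun _ => gaussianReal 0 1) (f := fun i x => ENNReal.ofReal
    (Real.exp (s * ((stdOrthonormalBasis ℝ E).repr h i + (Real.sqrt 2)⁻¹ * x) ^ 2)))
    (fun i => by fun_prop)]
  simp_rw [lintegral_exp_sq_gaussianReal hs]
  rw [← ENNReal.ofReal_prod_of_nonneg (fun _ _ => by positivity), Finset.prod_mul_distrib,
    Finset.prod_const, ← Real.exp_sum, ← Finset.sum_div, ← Finset.mul_sum,
    ← EuclideanSpace.real_norm_sq_eq, LinearIsometryEquiv.norm_map]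
  simp

/-- Hyperplanes are null sets. -/
theorem halfGaussian_inner_eq_zero {v : E} (hv : v ≠ 0) :
    halfGaussian E {x | inner ℝ v x = 0} = 0 := by
  have hpos : 0 < ‖v‖ := norm_pos_iff.2 hv
  -- The projection on v is a real Gaussian of variance ‖v‖²/2 > 0, which has no atoms.
  have hmap : (halfGaussian E).map (fun x => inner ℝ v x) =
      gaussianReal 0 (‖v‖ ^ 2 / 2).toNNReal := by
    have : IsProbabilityMeasure ((halfGaussian E).map (fun x => inner ℝ v x)) :=
      Measure.isProbabilityMeasure_map (by fun_prop)
    refine Measure.ext_of_charFun (funext fun t => ?_)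
    rw [charFun_apply, integral_map (by fun_prop) (by fun_prop), charFun_gaussianReal]
    have : ∀ x : E, inner ℝ (inner ℝ v x : ℝ) t = inner ℝ x (t • v) := by
      intro x
      rw [inner_smul_right, real_inner_comm v x]
      simp
    simp_rw [this]
    rw [← charFun_apply, charFun_halfGaussian, norm_smul, Real.coe_toNNReal _ (by positivity)]
    congr 1
    rw [mul_pow, Real.norm_eq_abs, sq_abs]
    push_cast
    ring
  have hna : NullMeasurableSet {x : E | inner ℝ v x = 0} (halfGaussian E) :=
    (measurableSet_eq_fun (by fun_prop) (by fun_prop)).nullMeasurableSet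
  have : {x : E | inner ℝ v x = 0} = (fun x => inner ℝ v x) ⁻¹' {(0 : ℝ)} := by ext; simp
  have hv' : (‖v‖ ^ 2 / 2).toNNReal ≠ 0 := by
    rw [Ne, Real.toNNReal_eq_zero, not_le]; positivity
  have := nullSingletonClass_gaussianReal (μ := 0) hv'
  rw [‹{x : E | inner ℝ v x = 0} = _›, ← Measure.map_apply (by fun_prop)
    (measurableSet_singleton 0), hmap]
  simp

end HalfGaussian

/-! ### Inverse Gram entries as squared distances. -/

section ResidualSq

variable {E : Type*} [NormedAddCommGroup E] [InnerProductSpace ℂ E]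

/-- `1 / [G⁻¹]_{k,k}` for the Gram matrix `G` of the family `c`. When the other vectors are linearly
independent, it is the squared distance from `c k` to their span. -/
noncomputable def residualSq {ι : Type*} [Fintype ι] [DecidableEq ι] (c : ι → E) (k : ι) : ℝ :=
  1 / ((gram ℂ c)⁻¹ k k).re

theorem residualSq_isometry {ι : Type*} [Fintype ι] [DecidableEq ι] (c : ι → E) (k : ι)
    (U : E →ₗᵢ[ℂ] E) : residualSq (fun i => U (c i)) k = residualSq c k := by
  have : gram ℂ (fun i => U (c i)) = gram ℂ c := by
    ext i j
    simp [gram_apply]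
  rw [residualSq, residualSq, this]

/-- Let w be the coefficient vector of z in the family c, so `w k = 1`. Then Gw lists the inner
products of the `c i` with z, so Gw = ‖z‖² e_k. Inverting G and reading coordinate k gives the
value. -/
theorem residualSq_insertNth_eq_of_orthogonal {m : ℕ} (k : Fin (m + 1)) (x : E) {Y : Fin m → E}
    (hY : LinearIndependent ℂ Y) (β : Fin m → ℂ)
    (hz : ∀ j, inner ℂ (Y j) (x - ∑ i, β i • Y i) = 0) :
    residualSq (k.insertNth x Y : Fin (m + 1) → E) k = ‖x - ∑ i, β i • Y i‖ ^ 2 := by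
  set z := x - ∑ i, β i • Y i with hzdef
  set c : Fin (m + 1) → E := k.insertNth x Y with hc
  set w : Fin (m + 1) → ℂ := k.insertNth 1 (fun i => -β i) with hw
  have hck : c k = x := by simp [hc]
  have hcj : ∀ j, c (k.succAbove j) = Y j := by simp [hc]
  have hwk : w k = 1 := by simp [hw]
  have hwj : ∀ j, w (k.succAbove j) = -β j := by simp [hw]
  have hzsum : ∑ j, w j • c j = z := by
    rw [Fin.sum_univ_succAbove _ k]
    simp [hck, hcj, hwk, hwj, hzdef, sub_eq_add_neg]
  have hxz : inner ℂ x z = ((‖z‖ ^ 2 : ℝ) : ℂ) := by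
    have h1 : inner ℂ z z = inner ℂ x z := by
      nth_rewrite 1 [← hzsum]
      rw [sum_inner, Fin.sum_univ_succAbove _ k]
      simp only [inner_smul_left, hck, hcj, hwk, hwj, hz]
      simp
    rw [← h1, inner_self_eq_norm_sq_to_K]
    push_cast
    rfl
  have hGw : gram ℂ c *ᵥ w = ((‖z‖ ^ 2 : ℝ) : ℂ) • Pi.single k 1 := by
    ext i
    have h1 : (gram ℂ c *ᵥ w) i = inner ℂ (c i) z := by
      rw [← hzsum, inner_sum]
      simp only [mulVec, dotProduct, gram_apply, inner_smul_right]
      exact Finset.sum_congr rfl fun j _ => mul_comm _ _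
    rw [h1]
    rcases Fin.eq_self_or_eq_succAbove k i with rfl | ⟨j, rfl⟩
    · rw [hck, hxz]; simp
    · rw [hcj, hz]; simp
  by_cases hdet : IsUnit (gram ℂ c).det
  · have h1 : w = ((‖z‖ ^ 2 : ℝ) : ℂ) • ((gram ℂ c)⁻¹ *ᵥ Pi.single k 1) := by
      rw [← mulVec_smul, ← hGw, mulVec_mulVec, nonsing_inv_mul _ hdet, one_mulVec]
    have h2 := congrFun h1 k
    rw [hwk, Pi.smul_apply, mulVec_single_one, smul_eq_mul] at h2
    have h3 : (1 : ℝ) = ‖z‖ ^ 2 * ((gram ℂ c)⁻¹ k k).re := by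
      have := congrArg Complex.re h2
      rw [Complex.re_ofReal_mul] at this
      simpa using this
    have h4 : ((gram ℂ c)⁻¹ k k).re ≠ 0 := fun h => by simp [h] at h3
    rw [residualSq, div_eq_iff h4, h3]
  -- For singular G the inverse is 0 and the left side is 1/0 = 0. The right side agrees: z ≠ 0
  -- together with independence of Y would make the whole family independent.
  · have hz0 : z = 0 := by
      by_contra hne
      refine hdet (isUnit_iff_ne_zero.2 ?_)
      rw [det_gram_ne_zero_iff_linearIndependent, Fintype.linearIndependent_iff]
      intro g hg
      rw [Fin.sum_univ_succAbove _ k] at hg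
      simp only [hck, hcj] at hg
      have hgk : g k = 0 := by
        have h5 := congrArg (fun v => inner ℂ z v) hg
        have h6 : ∀ j, inner ℂ z (Y j) = 0 := fun j => inner_eq_zero_symm.1 (hz j)
        simp only [inner_add_right, inner_sum, inner_smul_right, h6] at h5
        have h7 : inner ℂ z x = ((‖z‖ ^ 2 : ℝ) : ℂ) := by
          rw [← inner_conj_symm, hxz, Complex.conj_ofReal]
        rw [h7] at h5
        simpa [hne] using h5
      rw [hgk, zero_smul, zero_add] at hg
      have h8 := Fintype.linearIndependent_iff.1 hY (fun j => g (k.succAbove j)) hg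
      intro i
      rcases Fin.eq_self_or_eq_succAbove k i with rfl | ⟨j, rfl⟩
      · exact hgk
      · exact h8 j
    rw [residualSq, nonsing_inv_apply_not_isUnit _ hdet, hz0]
    simp

/-- The residual is the squared norm of a coisometry onto a space of complementary dimension. -/
theorem exists_residualSq_insertNth_eq_norm_sq [FiniteDimensional ℂ E] {m d : ℕ}
    (k : Fin (m + 1)) {Y : Fin m → E}
    (hY : LinearIndependent ℂ Y) (hd : Module.finrank ℂ E = m + d) :
    ∃ (T : E →L[ℂ] EuclideanSpace ℂ (Fin d)) (S : EuclideanSpace ℂ (Fin d) → E),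
      (∀ t, ‖S t‖ = ‖t‖) ∧ (∀ x t, inner ℂ (T x) t = inner ℂ x (S t)) ∧ (∀ x, ‖T x‖ ≤ ‖x‖) ∧
      ∀ x, residualSq (k.insertNth x Y : Fin (m + 1) → E) k = ‖T x‖ ^ 2 := by
  set K := Submodule.span ℂ (Set.range Y) with hK
  have hKfin : Module.finrank ℂ K = m := by
    rw [hK, finrank_span_eq_card hY, Fintype.card_fin]
  have hKo : Module.finrank ℂ Kᗮ = d := by
    have := K.finrank_add_finrank_orthogonal
    omega
  let b : OrthonormalBasis (Fin d) ℂ Kᗮ := (stdOrthonormalBasis ℂ Kᗮ).reindex (finCongr hKo)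
  -- T projects onto the orthogonal complement of the span and takes coordinates; S embeds
  -- coordinates back and is its adjoint.
  refine ⟨b.repr.toContinuousLinearEquiv.toContinuousLinearMap.comp Kᗮ.orthogonalProjectionOnto,
    fun t => (b.repr.symm t : E), fun t => ?_, fun x t => ?_, fun x => ?_, fun x => ?_⟩
  · change ‖((b.repr.symm t : Kᗮ) : E)‖ = _
    rw [← Submodule.coe_norm, LinearIsometryEquiv.norm_map]
  · change inner ℂ (b.repr (Kᗮ.orthogonalProjectionOnto x)) t = _
    rw [← b.repr.symm.inner_map_map, LinearIsometryEquiv.symm_apply_apply,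
      Submodule.inner_orthogonalProjectionOnto_eq_of_mem_right]
  · change ‖b.repr (Kᗮ.orthogonalProjectionOnto x)‖ ≤ _
    rw [LinearIsometryEquiv.norm_map]
    exact Submodule.norm_orthogonalProjectionOnto_apply_le _ _
  · change _ = ‖b.repr (Kᗮ.orthogonalProjectionOnto x)‖ ^ 2
    rw [LinearIsometryEquiv.norm_map]
    obtain ⟨β, hβ⟩ := (Submodule.mem_span_range_iff_exists_fun ℂ).1
      (hK ▸ (K.orthogonalProjectionOnto x).2)
    have hcoe : ((Kᗮ.orthogonalProjectionOnto x : Kᗮ) : E) = x - ∑ i, β i • Y i := by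
      rw [hβ]
      have := K.starProjection_add_starProjection_orthogonal x
      exact eq_sub_of_add_eq' this
    rw [residualSq_insertNth_eq_of_orthogonal k x hY β, ← hcoe, ← Submodule.coe_norm]
    intro j
    rw [← hcoe]
    exact (Submodule.mem_orthogonal K _).1 (Kᗮ.orthogonalProjectionOnto x).2 _
      (Submodule.subset_span ⟨j, rfl⟩)

end ResidualSq

/-! ### Gaussian vectors in `ℂⁿ`. -/

section ComplexGaussian

variable {n : ℕ}

theorem EuclideanSpace.inner_real_eq_re_inner (x y : EuclideanSpace ℂ (Fin n)) :
    inner ℝ x y = (inner ℂ x y).re := by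
  rw [PiLp.inner_apply, PiLp.inner_apply, Complex.re_sum]
  rfl

/-- Cramer's rule makes the entry a quotient of polynomials in Gram entries. With 0⁻¹ = 0 the
formula also covers singular Gram matrices. -/
theorem measurable_residualSq {ι : Type*} [Fintype ι] [DecidableEq ι] (k : ι) :
    Measurable (fun c : ι → EuclideanSpace ℂ (Fin n) => residualSq c k) := by
  have hG : ∀ i j, Measurable (fun c : ι → EuclideanSpace ℂ (Fin n) => gram ℂ c i j) := by
    intro i j
    simp only [gram_apply]
    fun_prop
  have hdet : ∀ M : (ι → EuclideanSpace ℂ (Fin n)) → Matrix ι ι ℂ,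
      (∀ i j, Measurable (fun c => M c i j)) → Measurable (fun c => (M c).det) := by
    intro M hM
    simp only [det_apply]
    exact Finset.measurable_sum _ fun σ _ =>
      (Finset.measurable_prod _ fun i _ => hM _ _).const_smul _
  have heq : (fun c : ι → EuclideanSpace ℂ (Fin n) => residualSq c k) = fun c =>
      1 / ((gram ℂ c).det⁻¹ * ((gram ℂ c).updateRow k (Pi.single k 1)).det).re := by
    funext c
    rw [residualSq, inv_def, Matrix.smul_apply, smul_eq_mul, Ring.inverse_eq_inv', adjugate_apply]
  rw [heq]
  refine measurable_const.div (Complex.measurable_re.comp ((hdet _ hG).inv.mul (hdet _ ?_)))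
  intro i j
  by_cases h : i = k
  · subst h; simp
  · simp only [updateRow_ne h]; exact hG i j

theorem halfGaussian_map_linearIsometryEquiv
    (U : EuclideanSpace ℂ (Fin n) ≃ₗᵢ[ℂ] EuclideanSpace ℂ (Fin n)) :
    (halfGaussian (EuclideanSpace ℂ (Fin n))).map U = halfGaussian _ := by
  refine halfGaussian_map_of_isometry_adjoint U U.continuous.measurable U.symm
    U.symm.norm_map fun x t => ?_
  rw [EuclideanSpace.inner_real_eq_re_inner, EuclideanSpace.inner_real_eq_re_inner,
    ← U.symm.inner_map_map, U.symm_apply_apply]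

/-- A proper subspace lies in the real hyperplane orthogonal to some v ≠ 0. -/
theorem halfGaussian_submodule_eq_zero {K : Submodule ℂ (EuclideanSpace ℂ (Fin n))}
    (hK : Module.finrank ℂ K < n) : halfGaussian (EuclideanSpace ℂ (Fin n)) K = 0 := by
  have hne : Kᗮ ≠ ⊥ := by
    intro h
    rw [Submodule.orthogonal_eq_bot_iff] at h
    rw [h, finrank_top, finrank_euclideanSpace_fin] at hK
    exact lt_irrefl _ hK
  obtain ⟨v, hv, hv0⟩ := Submodule.exists_mem_ne_zero_of_ne_bot hne
  refine measure_mono_null (fun x hx => ?_) (halfGaussian_inner_eq_zero hv0)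
  have : inner ℂ v x = 0 := Submodule.inner_left_of_mem_orthogonal hx hv
  change inner ℝ v x = 0
  rw [EuclideanSpace.inner_real_eq_re_inner, this, Complex.zero_re]

/-- At most `n` independent Gaussian vectors of `ℂⁿ` are almost surely linearly independent. -/
theorem ae_linearIndependent_pi_halfGaussian {m : ℕ} (hm : m ≤ n) :
    ∀ᵐ Y ∂(Measure.pi fun _ : Fin m => halfGaussian (EuclideanSpace ℂ (Fin n))),
      LinearIndependent ℂ Y := by
  induction m with
  | zero => exact ae_of_all _ fun Y => linearIndependent_empty_type
  | succ m ih =>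
    have hmp := measurePreserving_piFinSuccAbove
      (fun _ : Fin (m + 1) => halfGaussian (EuclideanSpace ℂ (Fin n))) 0
    have hms : MeasurableSet {Y : Fin (m + 1) → EuclideanSpace ℂ (Fin n) |
        LinearIndependent ℂ Y} := isOpen_setOfPred_linearIndependent.measurableSet
    have hcons : Measurable (fun p : EuclideanSpace ℂ (Fin n) ×
        (Fin m → EuclideanSpace ℂ (Fin n)) =>
        (Fin.cons p.1 p.2 : Fin (m + 1) → EuclideanSpace ℂ (Fin n))) := by
      refine measurable_pi_lambda _ fun i => ?_
      refine Fin.cases ?_ (fun j => ?_) i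
      · simpa using measurable_fst
      · simp only [Fin.cons_succ]; fun_prop
    have h : ∀ᵐ p ∂((halfGaussian (EuclideanSpace ℂ (Fin n))).prod
        (Measure.pi fun _ : Fin m => halfGaussian (EuclideanSpace ℂ (Fin n)))),
        LinearIndependent ℂ (Fin.cons p.1 p.2 : Fin (m + 1) → EuclideanSpace ℂ (Fin n)) := by
      -- The swap lets Y be fixed first; x then avoids the span of Y, of dimension m < n, almost
      -- surely.
      rw [← Measure.prod_swap]
      refine (ae_map_iff measurable_swap.aemeasurable (hcons hms)).2 ?_
      refine (Measure.ae_prod_iff_ae_ae (measurable_swap (hcons hms))).2 ?_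
      filter_upwards [ih (by omega)] with Y hY
      have hnull : halfGaussian (EuclideanSpace ℂ (Fin n))
          (Submodule.span ℂ (Set.range Y) : Set (EuclideanSpace ℂ (Fin n))) = 0 := by
        refine halfGaussian_submodule_eq_zero ?_
        rw [finrank_span_eq_card hY, Fintype.card_fin]
        omega
      filter_upwards [measure_eq_zero_iff_ae_notMem.1 hnull] with x hx
      exact linearIndependent_finCons.2 ⟨hY, hx⟩
    have h2 := hmp.quasiMeasurePreserving.ae h
    filter_upwards [h2] with Y hY
    convert hY using 1
    ext i
    refine Fin.cases ?_ (fun j => ?_) i <;> simp [MeasurableEquiv.piFinSuccAbove, Fin.tail]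

theorem halfGaussian_map_coisometry {d : ℕ}
    (T : EuclideanSpace ℂ (Fin n) →L[ℂ] EuclideanSpace ℂ (Fin d))
    (S : EuclideanSpace ℂ (Fin d) → EuclideanSpace ℂ (Fin n)) (hS : ∀ t, ‖S t‖ = ‖t‖)
    (hTS : ∀ x t, inner ℂ (T x) t = inner ℂ x (S t)) :
    (halfGaussian (EuclideanSpace ℂ (Fin n))).map T = halfGaussian _ := by
  refine halfGaussian_map_of_isometry_adjoint T T.continuous.measurable S hS fun x t => ?_
  rw [EuclideanSpace.inner_real_eq_re_inner, EuclideanSpace.inner_real_eq_re_inner, hTS]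

/-- The real dimension is 2n, so the square roots pair up. -/
theorem lintegral_exp_norm_sq_complexGaussian {s : ℝ} (hs : s < 1) (h : EuclideanSpace ℂ (Fin n)) :
    ∫⁻ x, ENNReal.ofReal (Real.exp (s * ‖h + x‖ ^ 2)) ∂(halfGaussian (EuclideanSpace ℂ (Fin n))) =
      ENNReal.ofReal (1 / (1 - s) ^ n * Real.exp (s * ‖h‖ ^ 2 / (1 - s))) := by
  rw [lintegral_exp_norm_sq_halfGaussian hs, finrank_real_of_complex, finrank_euclideanSpace_fin,
    pow_mul, inv_pow, Real.sq_sqrt (by linarith), inv_pow, one_div]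

/-- The squared norm of a standard complex Gaussian vector of `ℂⁿ` is `Gamma(n, 1)`. -/
theorem halfGaussian_map_norm_sq (hn : 0 < n) :
    (halfGaussian (EuclideanSpace ℂ (Fin n))).map (fun x => ‖x‖ ^ 2) =
      gammaMeasure (n : ℝ) 1 := by
  have hn' : (0 : ℝ) < n := by exact_mod_cast hn
  have hm : Measurable (fun x : EuclideanSpace ℂ (Fin n) => ‖x‖ ^ 2) := by fun_prop
  have := isProbabilityMeasure_gammaMeasure hn' one_pos
  have : IsProbabilityMeasure ((halfGaussian (EuclideanSpace ℂ (Fin n))).map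
      (fun x => ‖x‖ ^ 2)) := Measure.isProbabilityMeasure_map hm.aemeasurable
  have hl : ∀ s < (1 : ℝ), ∫⁻ x, ENNReal.ofReal (Real.exp (s * ‖x‖ ^ 2))
      ∂(halfGaussian (EuclideanSpace ℂ (Fin n))) = ENNReal.ofReal (1 / (1 - s) ^ n) := by
    intro s hs
    have := lintegral_exp_norm_sq_complexGaussian hs (0 : EuclideanSpace ℂ (Fin n))
    simpa using this
  have hg : gammaMeasure (n : ℝ) 1 =
      volume.withDensity (fun t => ENNReal.ofReal (gammaPDFReal n 1 t)) := rfl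
  have hnn := gammaPDFReal_nonneg hn' one_pos
  refine measure_ext_of_mgf_eqOn_Iio one_pos (fun s hs => ?_) (fun s hs => ?_) (fun s hs => ?_)
  · rw [integrable_map_measure (by fun_prop) hm.aemeasurable]
    refine ⟨by fun_prop, ?_⟩
    rw [Function.comp_def, hasFiniteIntegral_iff_ofReal (ae_of_all _ fun _ => Real.exp_nonneg _)]
    exact (hl s hs).trans_lt ENNReal.ofReal_lt_top
  · rw [hg, integrable_withDensity_iff (by fun_prop) (by simp)]
    simp_rw [ENNReal.toReal_ofReal (hnn _)]
    exact integrable_exp_mul_gammaPDFReal hn' one_pos hs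
  · rw [mgf_id_map hm.aemeasurable, mgf, integral_eq_lintegral_of_nonneg_ae
      (ae_of_all _ fun _ => Real.exp_nonneg _) (by fun_prop), hl s hs, mgf, hg,
      integral_withDensity_eq_integral_toReal_smul (by fun_prop) (by simp)]
    simp_rw [ENNReal.toReal_ofReal (hnn _), id, smul_eq_mul, mul_comm (gammaPDFReal _ _ _)]
    have := integral_exp_mul_gammaPDFReal hn one_pos (s := s) (by simpa using hs)
    simp only [div_one, mul_one] at this
    rw [this, ENNReal.toReal_ofReal]
    have : 0 < 1 - s := by linarith
    positivity

/-- These are the moments of Gamma(n, 1): the factor `t^q` raises the shape to n + q and leaves a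
density of mass 1. -/
theorem lintegral_norm_sq_pow_halfGaussian (hn : 0 < n) (q : ℕ) :
    ∫⁻ x, ENNReal.ofReal ((‖x‖ ^ 2) ^ q) ∂(halfGaussian (EuclideanSpace ℂ (Fin n))) =
      ENNReal.ofReal ((ascPochhammer ℝ q).eval (n : ℝ)) := by
  have hn' : (0 : ℝ) < n := by exact_mod_cast hn
  have hm : Measurable (fun x : EuclideanSpace ℂ (Fin n) => ‖x‖ ^ 2) := by fun_prop
  have h1 : ∫⁻ x, ENNReal.ofReal ((‖x‖ ^ 2) ^ q) ∂(halfGaussian (EuclideanSpace ℂ (Fin n))) =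
      ∫⁻ t, ENNReal.ofReal (t ^ q) ∂(gammaMeasure (n : ℝ) 1) := by
    rw [← halfGaussian_map_norm_sq hn, lintegral_map (by fun_prop) hm]
  have hpos : 0 ≤ (ascPochhammer ℝ q).eval (n : ℝ) := (ascPochhammer_pos q _ hn').le
  rw [h1, gammaMeasure, lintegral_withDensity_eq_lintegral_mul _
    (show Measurable (gammaPDF (n : ℝ) 1) from (measurable_gammaPDFReal _ _).ennreal_ofReal)
    (by fun_prop)]
  simp only [Pi.mul_apply, gammaPDF]
  simp_rw [← ENNReal.ofReal_mul (gammaPDFReal_nonneg hn' one_pos _),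
    mul_comm (gammaPDFReal _ _ _), pow_mul_gammaPDFReal hn, ENNReal.ofReal_mul hpos]
  rw [lintegral_const_mul _ (by fun_prop)]
  have := lintegral_gammaPDF_eq_one (a := ((n + q : ℕ) : ℝ)) (r := 1) (by positivity) one_pos
  unfold gammaPDF at this
  rw [this, mul_one]

end ComplexGaussian

/-! ### The random noncentrality and its moments. -/

section Residual

variable {n m d : ℕ}

theorem measurable_insertNth {E : Type*} [MeasurableSpace E] (k : Fin (m + 1)) :
    Measurable (fun p : E × (Fin m → E) => (k.insertNth p.1 p.2 : Fin (m + 1) → E)) := by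
  refine measurable_pi_lambda _ fun i => ?_
  rcases Fin.eq_self_or_eq_succAbove k i with rfl | ⟨j, rfl⟩
  · simpa using measurable_fst
  · simp only [Fin.insertNth_apply_succAbove]; fun_prop

/-- The squared distance from `x` to the span of `Y`, when `Y` is linearly independent. -/
noncomputable def residualTo (k : Fin (m + 1)) (x : EuclideanSpace ℂ (Fin n))
    (Y : Fin m → EuclideanSpace ℂ (Fin n)) : ℝ :=
  residualSq (k.insertNth x Y : Fin (m + 1) → EuclideanSpace ℂ (Fin n)) k

theorem measurable_residualTo (k : Fin (m + 1)) :
    Measurable (fun p : EuclideanSpace ℂ (Fin n) × (Fin m → EuclideanSpace ℂ (Fin n)) =>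
      residualTo k p.1 p.2) :=
  (measurable_residualSq k).comp (measurable_insertNth k)

attribute [irreducible] residualTo

theorem measurable_residualTo_left (k : Fin (m + 1)) (x : EuclideanSpace ℂ (Fin n)) :
    Measurable (residualTo k x : (Fin m → EuclideanSpace ℂ (Fin n)) → ℝ) :=
  Measurable.of_uncurry_left (f := residualTo k) (measurable_residualTo k)

/-- T depends on Y but not on x, so conditioning on Y reduces the residual to the norm of a Gaussian
vector in `ℂᵈ`. -/
theorem exists_residualTo_eq_norm_sq (hd : n = m + d) (k : Fin (m + 1))
    {Y : Fin m → EuclideanSpace ℂ (Fin n)} (hY : LinearIndependent ℂ Y) :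
    ∃ T : EuclideanSpace ℂ (Fin n) →L[ℂ] EuclideanSpace ℂ (Fin d),
      (halfGaussian (EuclideanSpace ℂ (Fin n))).map T = halfGaussian _ ∧ (∀ x, ‖T x‖ ≤ ‖x‖) ∧
      ∀ x, residualTo k x Y = ‖T x‖ ^ 2 := by
  obtain ⟨T, S, hS, hTS, hle, hT⟩ := exists_residualSq_insertNth_eq_norm_sq k hY
    (d := d) (by rw [finrank_euclideanSpace_fin, hd])
  refine ⟨T, halfGaussian_map_coisometry T S hS hTS, hle, fun x => ?_⟩
  rw [residualTo, hT]

/-- Extend each unit vector to an orthonormal basis and send one basis to the other. -/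
theorem exists_linearIsometryEquiv_apply_eq {u v : EuclideanSpace ℂ (Fin n)} (hu : ‖u‖ = 1)
    (hv : ‖v‖ = 1) :
    ∃ U : EuclideanSpace ℂ (Fin n) ≃ₗᵢ[ℂ] EuclideanSpace ℂ (Fin n), U u = v := by
  rcases n with _ | n
  · have : u = 0 := Subsingleton.elim _ _
    simp [this] at hu
  have key : ∀ w : EuclideanSpace ℂ (Fin (n + 1)), ‖w‖ = 1 →
      ∃ b : OrthonormalBasis (Fin (n + 1)) ℂ (EuclideanSpace ℂ (Fin (n + 1))), b 0 = w := by
    intro w hw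
    have ho : Orthonormal ℂ (Set.domRestrict ({0} : Set (Fin (n + 1))) fun _ => w) := by
      refine ⟨fun _ => hw, fun i j hij => absurd (Subsingleton.elim i j) hij⟩
    obtain ⟨b, hb⟩ := ho.exists_orthonormalBasis_extension_of_card_eq (by simp)
    exact ⟨b, hb 0 rfl⟩
  obtain ⟨b, hb⟩ := key u hu
  obtain ⟨b', hb'⟩ := key v hv
  exact ⟨b.equiv b' (Equiv.refl _), by rw [← hb, OrthonormalBasis.equiv_apply_basis]; simpa⟩

local notation "𝔾" => halfGaussian (EuclideanSpace ℂ (Fin n))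
local notation "𝔾ₘ" => Measure.pi fun _ : Fin m => halfGaussian (EuclideanSpace ℂ (Fin n))

/-- Applying U to Y as well preserves the Gram matrix, hence the residual, and the law of Y is
invariant under U. -/
theorem lintegral_residualTo_isometry (k : Fin (m + 1))
    (U : EuclideanSpace ℂ (Fin n) ≃ₗᵢ[ℂ] EuclideanSpace ℂ (Fin n))
    (x : EuclideanSpace ℂ (Fin n)) {f : ℝ → ENNReal} (hf : Measurable f) :
    ∫⁻ Y, f (residualTo k (U x) Y) ∂𝔾ₘ = ∫⁻ Y, f (residualTo k x Y) ∂𝔾ₘ := by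
  have hU : MeasurePreserving U 𝔾 𝔾 :=
    ⟨U.continuous.measurable, halfGaussian_map_linearIsometryEquiv U⟩
  have hpi : MeasurePreserving (fun (Y : Fin m → EuclideanSpace ℂ (Fin n)) i => U (Y i)) 𝔾ₘ 𝔾ₘ :=
    measurePreserving_pi _ _ fun _ => hU
  rw [← hpi.lintegral_comp (f := fun Y => f (residualTo k (U x) Y))
    (hf.comp (measurable_residualTo_left k _))]
  refine lintegral_congr fun Y => ?_
  rw [residualTo, residualTo, ← residualSq_isometry (k.insertNth x Y) k U.toLinearIsometry]
  congr 2
  ext1 i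
  rcases Fin.eq_self_or_eq_succAbove k i with rfl | ⟨j, rfl⟩ <;> simp

/-- Moments of the residual of a fixed vector with respect to Gaussian vectors. -/
theorem lintegral_residualTo_pow (hd : n = m + d) (hd0 : 0 < d) (k : Fin (m + 1))
    (h : EuclideanSpace ℂ (Fin n)) (q : ℕ) :
    ∫⁻ Y, ENNReal.ofReal (residualTo k h Y ^ q) ∂𝔾ₘ =
      ENNReal.ofReal ((‖h‖ ^ 2) ^ q * ((ascPochhammer ℝ q).eval (d : ℝ) /
        (ascPochhammer ℝ q).eval (n : ℝ))) := by
  have hn : 0 < n := by omega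
  set u : EuclideanSpace ℂ (Fin n) := EuclideanSpace.single ⟨0, hn⟩ 1 with hu
  have hu1 : ‖u‖ = 1 := by simp [hu]
  set C := ∫⁻ Y, ENNReal.ofReal (residualTo k u Y ^ q) ∂𝔾ₘ with hC
  -- Unitary invariance moves the direction of x to u; for independent Y the residual is ‖Tx‖²,
  -- which supplies the factor ‖x‖².
  have hpsi : ∀ x : EuclideanSpace ℂ (Fin n), ∫⁻ Y, ENNReal.ofReal (residualTo k x Y ^ q) ∂𝔾ₘ =
      ENNReal.ofReal ((‖x‖ ^ 2) ^ q) * C := by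
    intro x
    obtain ⟨v, hv, hx⟩ : ∃ v : EuclideanSpace ℂ (Fin n), ‖v‖ = 1 ∧ x = (‖x‖ : ℂ) • v := by
      by_cases hx : x = 0
      · exact ⟨u, hu1, by simp [hx]⟩
      · have hx' : ‖x‖ ≠ 0 := norm_ne_zero_iff.2 hx
        refine ⟨((‖x‖⁻¹ : ℝ) : ℂ) • x, ?_, ?_⟩
        · rw [norm_smul]; simp [hx']
        · rw [smul_smul, ← Complex.ofReal_mul, mul_inv_cancel₀ hx']; simp
    obtain ⟨U, hU⟩ := exists_linearIsometryEquiv_apply_eq hu1 hv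
    rw [hC, ← lintegral_residualTo_isometry k U u
      (f := fun t => ENNReal.ofReal (t ^ q)) (by fun_prop), hU,
      ← lintegral_const_mul _ ((measurable_residualTo_left k v).pow_const q).ennreal_ofReal]
    refine lintegral_congr_ae ?_
    filter_upwards [ae_linearIndependent_pi_halfGaussian (n := n) (m := m) (by omega)] with Y hY
    obtain ⟨T, -, -, hT⟩ := exists_residualTo_eq_norm_sq hd k hY
    rw [hT, hT, ← ENNReal.ofReal_mul (by positivity)]
    nth_rewrite 1 [hx]
    rw [map_smul, norm_smul, Complex.norm_real, norm_norm, mul_pow, mul_pow]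
  have hnpos : 0 < (ascPochhammer ℝ q).eval (n : ℝ) := ascPochhammer_pos q _ (by exact_mod_cast hn)
  -- C is found by averaging over a Gaussian x in two orders: Y first gives (n)_q C, x first gives
  -- (d)_q.
  have h1 : ∫⁻ x, ∫⁻ Y, ENNReal.ofReal (residualTo k x Y ^ q) ∂𝔾ₘ ∂𝔾 =
      ENNReal.ofReal ((ascPochhammer ℝ q).eval (n : ℝ)) * C := by
    simp_rw [hpsi]
    rw [lintegral_mul_const _ (by fun_prop), lintegral_norm_sq_pow_halfGaussian hn]
  have h2 : ∫⁻ x, ∫⁻ Y, ENNReal.ofReal (residualTo k x Y ^ q) ∂𝔾ₘ ∂𝔾 =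
      ENNReal.ofReal ((ascPochhammer ℝ q).eval (d : ℝ)) := by
    rw [lintegral_lintegral_swap 
      ((measurable_residualTo k).pow_const q).ennreal_ofReal.aemeasurable]
    have : ∀ᵐ Y ∂𝔾ₘ, ∫⁻ x, ENNReal.ofReal (residualTo k x Y ^ q) ∂𝔾 =
        ENNReal.ofReal ((ascPochhammer ℝ q).eval (d : ℝ)) := by
      filter_upwards [ae_linearIndependent_pi_halfGaussian (n := n) (m := m) (by omega)] with Y hY
      obtain ⟨T, hTmap, -, hT⟩ := exists_residualTo_eq_norm_sq hd k hY
      simp_rw [hT]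
      rw [← lintegral_norm_sq_pow_halfGaussian hd0, ← hTmap,
        lintegral_map (by fun_prop) T.continuous.measurable]
    rw [lintegral_congr_ae this, lintegral_const, measure_univ, mul_one]
  have hCeq : C = ENNReal.ofReal ((ascPochhammer ℝ q).eval (d : ℝ) /
      (ascPochhammer ℝ q).eval (n : ℝ)) := by
    rw [h2] at h1
    rw [ENNReal.ofReal_div_of_pos hnpos, h1, mul_comm, ENNReal.mul_div_cancel_right
      (by simpa using hnpos) ENNReal.ofReal_ne_top]
  rw [hpsi, hCeq, ENNReal.ofReal_mul (by positivity)]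

theorem ae_residualTo_mem_Icc (hd : n = m + d) (k : Fin (m + 1))
    (h : EuclideanSpace ℂ (Fin n)) :
    ∀ᵐ Y ∂𝔾ₘ, residualTo k h Y ∈ Set.Icc 0 (‖h‖ ^ 2) := by
  filter_upwards [ae_linearIndependent_pi_halfGaussian (n := n) (m := m) (by omega)] with Y hY
  obtain ⟨T, -, hle, hT⟩ := exists_residualTo_eq_norm_sq hd k hY
  rw [hT]
  exact ⟨by positivity, by gcongr; exact hle h⟩

/-- This is the source of A_q: it is the q-th moment of the random noncentrality, divided by q!. -/
theorem integral_residualTo_pow_div_factorial (hd : n = m + d) (hd0 : 0 < d) (k : Fin (m + 1))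
    (h : EuclideanSpace ℂ (Fin n)) (q : ℕ) :
    ∫ Y, residualTo k h Y ^ q / (q.factorial : ℝ) ∂𝔾ₘ = seriesCoeff d n (‖h‖ ^ 2) q := by
  have hn : 0 < n := by omega
  have h1 : (0 : ℝ) ≤ (ascPochhammer ℝ q).eval (n : ℝ) :=
    (ascPochhammer_pos q _ (by exact_mod_cast hn)).le
  have h2 : (0 : ℝ) ≤ (ascPochhammer ℝ q).eval (d : ℝ) :=
    (ascPochhammer_pos q _ (by exact_mod_cast hd0)).le
  rw [integral_div, integral_eq_lintegral_of_nonneg_ae, lintegral_residualTo_pow hd hd0,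
    ENNReal.toReal_ofReal (by positivity), seriesCoeff]
  · ring
  · filter_upwards [ae_residualTo_mem_Icc hd k h] with Y hY
    exact pow_nonneg hY.1 q
  · exact ((measurable_residualTo_left k h).pow_const q).aestronglyMeasurable

/-- The series with coefficients `A_q(a)` are averages over the law of the residual. -/
theorem hasSum_seriesCoeff_mul (hd : n = m + d) (hd0 : 0 < d) (k : Fin (m + 1))
    (h : EuclideanSpace ℂ (Fin n)) {c : ℕ → ℝ} {B b : ℝ}
    (hc : ∀ q, |c q| ≤ B * b ^ q) :
    HasSum (fun q => seriesCoeff d n (‖h‖ ^ 2) q * c q)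
      (∫ Y, ∑' q, residualTo k h Y ^ q / (q.factorial : ℝ) * c q ∂𝔾ₘ) := by
  -- Since λ ≤ ‖h‖² almost surely, an exponential series at ‖h‖²b dominates and permits exchanging
  -- sum and mean.
  have hbound : ∀ q, ∀ᵐ Y ∂𝔾ₘ, ‖residualTo k h Y ^ q / (q.factorial : ℝ) * c q‖ ≤
      B * ((‖h‖ ^ 2 * b) ^ q / (q.factorial : ℝ)) := by
    intro q
    filter_upwards [ae_residualTo_mem_Icc hd k h] with Y hY
    rw [norm_mul, Real.norm_eq_abs, Real.norm_eq_abs, abs_of_nonneg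
      (div_nonneg (pow_nonneg hY.1 q) (by positivity))]
    have hB : 0 ≤ B * b ^ q := (abs_nonneg _).trans (hc q)
    calc residualTo k h Y ^ q / (q.factorial : ℝ) * |c q|
        ≤ (‖h‖ ^ 2) ^ q / (q.factorial : ℝ) * (B * b ^ q) := by
          have := pow_le_pow_left₀ hY.1 hY.2 q
          have := hc q
          gcongr
      _ = _ := by rw [mul_pow]; ring
  have hint : ∀ q, Integrable (fun Y => residualTo k h Y ^ q / (q.factorial : ℝ) * c q) 𝔾ₘ :=
    fun q => Integrable.of_bound ((((measurable_residualTo_left k h).pow_const q).div_const _).mul_const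
      _).aestronglyMeasurable _ (hbound q)
  have := hasSum_integral_of_summable_integral_norm hint (by
    refine Summable.of_nonneg_of_le (fun q => integral_nonneg fun _ => norm_nonneg _) (fun q => ?_)
      ((Real.summable_pow_div_factorial (‖h‖ ^ 2 * b)).mul_left B)
    refine (integral_mono_ae (hint q).norm (integrable_const _) (hbound q)).trans ?_
    simp)
  simp_rw [integral_mul_const, integral_residualTo_pow_div_factorial hd hd0] at this
  exact this

end Residual

/-! ### The signed series of gamma densities and their transforms. -/

theorem integrable_tsum_of_summable_integral_norm {α : Type*} [MeasurableSpace α] {μ : Measure α}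
    {F : ℕ → α → ℝ} (hF : ∀ i, Integrable (F i) μ) (hm : ∀ i, Measurable (F i))
    (hs : ∀ x, Summable fun i => F i x)
    (hsum : Summable fun i => ∫ a, ‖F i a‖ ∂μ) : Integrable (fun a => ∑' i, F i a) μ := by
  have hmeas : Measurable fun a => ∑' i, F i a :=
    measurable_of_tendsto_metrizable
      (fun k => Finset.measurable_sum (Finset.range k) fun i _ => hm i)
      (tendsto_pi_nhds.2 fun x => by simpa using (hs x).hasSum.tendsto_sum_nat)
  refine ⟨hmeas.aestronglyMeasurable, ?_⟩
  have h1 : ∀ a, ‖∑' i, F i a‖ₑ ≤ ∑' i, ‖F i a‖ₑ := fun a => enorm_tsum_le_tsum_enorm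
  refine (lintegral_mono h1).trans_lt ?_
  rw [lintegral_tsum fun i => (hm i).enorm.aemeasurable]
  have h2 : ∀ i, ∫⁻ a, ‖F i a‖ₑ ∂μ = ENNReal.ofReal (∫ a, ‖F i a‖ ∂μ) := fun i =>
    (ofReal_integral_norm_eq_lintegral_enorm (hF i)).symm
  simp_rw [h2]
  rw [← ENNReal.ofReal_tsum_of_nonneg (fun i => integral_nonneg fun _ => norm_nonneg _) hsum]
  exact ENNReal.ofReal_lt_top

section Series

variable {N NR : ℕ}

theorem seriesCoeff_nonneg (hN : 0 < N) (hNR : 0 < NR) {a : ℝ} (ha : 0 ≤ a) (q : ℕ) :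
    0 ≤ seriesCoeff N NR a q := by
  have h1 : (0 : ℝ) ≤ (ascPochhammer ℝ q).eval (NR : ℝ) :=
    (ascPochhammer_pos q _ (by exact_mod_cast hNR)).le
  have h2 : (0 : ℝ) ≤ (ascPochhammer ℝ q).eval (N : ℝ) :=
    (ascPochhammer_pos q _ (by exact_mod_cast hN)).le
  unfold seriesCoeff
  positivity

/-- Binomial expansion of the q-th power of σ/(1 - σ) = -1 + 1/(1 - σ). -/
theorem sum_choose_mul_one_div_pow {σ : ℝ} (hσ : σ < 1) (q : ℕ) :
    ∑ m ∈ Finset.range (q + 1), (q.choose m : ℝ) * (-1) ^ m * (1 / (1 - σ) ^ (N + q - m)) =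
      1 / (1 - σ) ^ N * (σ / (1 - σ)) ^ q := by
  have h1 : 1 - σ ≠ 0 := by linarith
  have h2 : σ / (1 - σ) = -1 + 1 / (1 - σ) := by field_simp; ring
  rw [h2, add_pow, Finset.mul_sum]
  refine Finset.sum_congr rfl fun m hm => ?_
  have hm' : m ≤ q := by simpa [Nat.lt_succ_iff] using hm
  rw [Nat.add_sub_assoc hm', pow_add, _root_.one_div_pow]
  field_simp

theorem mgfTerm_eq {a θ s : ℝ} (hs : s * θ < 1) (q : ℕ) :
    mgfTerm N NR a θ s q =
      seriesCoeff N NR a q * (1 / (1 - s * θ) ^ N * (s * θ / (1 - s * θ)) ^ q) := by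
  rw [mgfTerm, sum_choose_mul_one_div_pow hs]

/-- The alternating sum of gamma densities in a term of the density series. -/
noncomputable def gammaDiff (N : ℕ) (θ t : ℝ) (q : ℕ) : ℝ :=
  ∑ m ∈ Finset.range (q + 1),
    (q.choose m : ℝ) * (-1) ^ m * gammaPDFReal ((N + q - m : ℕ) : ℝ) (1 / θ) t

theorem pdfTerm_eq (a θ t : ℝ) (q : ℕ) :
    pdfTerm N NR a θ t q = seriesCoeff N NR a q * gammaDiff N θ t q := rfl

theorem measurable_gammaDiff (θ : ℝ) (q : ℕ) : Measurable fun t => gammaDiff N θ t q :=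
  Finset.measurable_sum _ fun _ _ => (measurable_gammaPDFReal _ _).const_mul _

/-- Each density is at most 1/θ and the binomials sum to 2^q. Geometric growth is harmless against
the factorial in A_q. -/
theorem abs_gammaDiff_le (hN : 0 < N) {θ : ℝ} (hθ : 0 < θ) (t : ℝ) (q : ℕ) :
    |gammaDiff N θ t q| ≤ 1 / θ * 2 ^ q := by
  have hr : 0 < 1 / θ := by positivity
  refine (Finset.abs_sum_le_sum_abs _ _).trans ?_
  have h2 : (2 : ℝ) ^ q = ∑ m ∈ Finset.range (q + 1), (q.choose m : ℝ) := by
    exact_mod_cast (Nat.sum_range_choose q).symm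
  rw [h2, Finset.mul_sum]
  refine Finset.sum_le_sum fun m hm => ?_
  have hm' : m ≤ q := by simpa [Nat.lt_succ_iff] using hm
  have hpos : 0 < N + q - m := by omega
  rw [abs_mul, abs_mul, abs_pow, abs_neg, abs_one, one_pow, mul_one, Nat.abs_cast,
    abs_of_nonneg (gammaPDFReal_nonneg (by exact_mod_cast hpos) hr t), mul_comm]
  gcongr
  exact gammaPDFReal_nat_le hpos hr t

/-- The density of a noncentral chi-square law as a Poisson mixture of gamma densities. -/
theorem tsum_pow_mul_gammaDiff (hN : 0 < N) {θ : ℝ} (hθ : 0 < θ) (t : ℝ) {l : ℝ} (hl : 0 ≤ l) :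
    ∑' q, l ^ q / (q.factorial : ℝ) * gammaDiff N θ t q =
      Real.exp (-l) *
        ∑' j, l ^ j / (j.factorial : ℝ) * gammaPDFReal ((N + j : ℕ) : ℝ) (1 / θ) t := by
  have hr : 0 < 1 / θ := by positivity
  have hexp : Real.exp (-l) = ∑' i, (-l) ^ i / (i.factorial : ℝ) := by
    rw [Real.exp_eq_exp_ℝ, NormedSpace.exp_eq_tsum_div]
  have hg0 : ∀ j, 0 ≤ gammaPDFReal ((N + j : ℕ) : ℝ) (1 / θ) t := fun j =>
    gammaPDFReal_nonneg (by positivity) hr t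
  have hs1 : Summable fun i => ‖(-l) ^ i / (i.factorial : ℝ)‖ :=
    (Real.summable_pow_div_factorial (-l)).norm
  have hs2 : Summable fun j =>
      ‖l ^ j / (j.factorial : ℝ) * gammaPDFReal ((N + j : ℕ) : ℝ) (1 / θ) t‖ := by
    refine Summable.of_nonneg_of_le (fun _ => norm_nonneg _) (fun j => ?_)
      ((Real.summable_pow_div_factorial l).mul_right (1 / θ))
    have h0 := hg0 j
    rw [Real.norm_of_nonneg (by positivity)]
    gcongr
    exact gammaPDFReal_nat_le (by omega) hr t
  -- Cauchy product with q = m + j: `(-l)^m/m! · l^j/j!` equals `l^q/q!` times `C(q,m) (-1)^m`.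
  rw [hexp, tsum_mul_tsum_eq_tsum_sum_range_of_summable_norm hs1 hs2]
  refine tsum_congr fun q => ?_
  rw [gammaDiff, Finset.mul_sum]
  refine Finset.sum_congr rfl fun m hm => ?_
  have hm' : m ≤ q := by simpa [Nat.lt_succ_iff] using hm
  rw [Nat.add_sub_assoc hm', Nat.cast_choose ℝ hm', neg_pow l]
  have h3 : l ^ q = l ^ m * l ^ (q - m) := by rw [← pow_add, Nat.add_sub_cancel' hm']
  rw [h3]
  have : (q.factorial : ℝ) ≠ 0 := by positivity
  field_simp

/-- The terms change sign, but the Poisson mixture form of the sum has only nonnegative ones. -/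
theorem tsum_pow_mul_gammaDiff_nonneg (hN : 0 < N) {θ : ℝ} (hθ : 0 < θ) (t : ℝ) {l : ℝ}
    (hl : 0 ≤ l) : 0 ≤ ∑' q, l ^ q / (q.factorial : ℝ) * gammaDiff N θ t q := by
  rw [tsum_pow_mul_gammaDiff hN hθ t hl]
  refine mul_nonneg (Real.exp_nonneg _) (tsum_nonneg fun j => ?_)
  have := gammaPDFReal_nonneg (a := ((N + j : ℕ) : ℝ)) (r := 1 / θ) (by positivity)
    (by positivity) t
  positivity

theorem integrable_exp_mul_gammaDiff (hN : 0 < N) {θ s : ℝ} (hθ : 0 < θ) (hs : s < 1 / θ)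
    (q : ℕ) : Integrable fun t => Real.exp (s * t) * gammaDiff N θ t q := by
  simp only [gammaDiff, Finset.mul_sum]
  refine integrable_finsetSum _ fun m hm => ?_
  have hm' : m ≤ q := by simpa [Nat.lt_succ_iff] using hm
  have hpos : 0 < N + q - m := by omega
  simp_rw [mul_left_comm (Real.exp _)]
  exact (integrable_exp_mul_gammaPDFReal (by exact_mod_cast hpos) (by positivity) hs).const_mul _

theorem integral_exp_mul_gammaDiff (hN : 0 < N) {θ s : ℝ} (hθ : 0 < θ) (hs : s < 1 / θ)
    (q : ℕ) : ∫ t, Real.exp (s * t) * gammaDiff N θ t q =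
      ∑ m ∈ Finset.range (q + 1), (q.choose m : ℝ) * (-1) ^ m *
        (1 / (1 - s * θ) ^ (N + q - m)) := by
  simp only [gammaDiff, Finset.mul_sum]
  have hpos : ∀ m ∈ Finset.range (q + 1), 0 < N + q - m := fun m hm => by
    have : m ≤ q := by simpa [Nat.lt_succ_iff] using hm
    omega
  simp_rw [mul_left_comm (Real.exp _)]
  rw [integral_finsetSum]
  · refine Finset.sum_congr rfl fun m hm => ?_
    rw [integral_const_mul, integral_exp_mul_gammaPDFReal (hpos m hm) hθ hs]
  · intro m hm
    exact (integrable_exp_mul_gammaPDFReal (by exact_mod_cast hpos m hm) (by positivity)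
      hs).const_mul _

/-- Dropping the signs turns the binomial sum into a power of 1 + 1/(1 - sθ). -/
theorem integral_norm_exp_mul_gammaDiff_le (hN : 0 < N) {θ s : ℝ} (hθ : 0 < θ) (hs : s < 1 / θ)
    (q : ℕ) : ∫ t, ‖Real.exp (s * t) * gammaDiff N θ t q‖ ≤
      1 / (1 - s * θ) ^ N * (1 + 1 / (1 - s * θ)) ^ q := by
  have hr : 0 < 1 / θ := by positivity
  have hσ : 0 < 1 - s * θ := by
    rw [lt_div_iff₀ hθ] at hs; linarith
  have hpos : ∀ m ∈ Finset.range (q + 1), 0 < N + q - m := fun m hm => by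
    have : m ≤ q := by simpa [Nat.lt_succ_iff] using hm
    omega
  have hint : ∀ m ∈ Finset.range (q + 1), Integrable fun t => (q.choose m : ℝ) *
      (Real.exp (s * t) * gammaPDFReal ((N + q - m : ℕ) : ℝ) (1 / θ) t) := fun m hm =>
    (integrable_exp_mul_gammaPDFReal (by exact_mod_cast hpos m hm) hr hs).const_mul _
  calc ∫ t, ‖Real.exp (s * t) * gammaDiff N θ t q‖
      ≤ ∫ t, ∑ m ∈ Finset.range (q + 1), (q.choose m : ℝ) *
          (Real.exp (s * t) * gammaPDFReal ((N + q - m : ℕ) : ℝ) (1 / θ) t) := by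
        refine integral_mono (integrable_exp_mul_gammaDiff hN hθ hs q).norm
          (integrable_finsetSum _ hint) fun t => ?_
        change ‖Real.exp (s * t) * gammaDiff N θ t q‖ ≤ _
        rw [norm_mul, Real.norm_of_nonneg (Real.exp_nonneg _)]
        simp_rw [mul_left_comm _ (Real.exp _)]
        rw [← Finset.mul_sum]
        refine mul_le_mul_of_nonneg_left ?_ (Real.exp_nonneg _)
        refine (Finset.abs_sum_le_sum_abs _ _).trans (Finset.sum_le_sum fun m hm => le_of_eq ?_)
        rw [abs_mul, abs_mul, abs_pow, abs_neg, abs_one, one_pow, mul_one, Nat.abs_cast,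
          abs_of_nonneg (gammaPDFReal_nonneg (by exact_mod_cast hpos m hm) hr t)]
    _ = ∑ m ∈ Finset.range (q + 1), (q.choose m : ℝ) * (1 / (1 - s * θ) ^ (N + q - m)) := by
        rw [integral_finsetSum _ hint]
        refine Finset.sum_congr rfl fun m hm => ?_
        rw [integral_const_mul, integral_exp_mul_gammaPDFReal (hpos m hm) hθ hs]
    _ = _ := by
        rw [add_pow, Finset.mul_sum]
        refine Finset.sum_congr rfl fun m hm => ?_
        have hm' : m ≤ q := by simpa [Nat.lt_succ_iff] using hm
        rw [Nat.add_sub_assoc hm', pow_add, _root_.one_div_pow, one_pow]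
        field_simp

theorem seriesCoeff_le (hN : 0 < N) (hNR : N ≤ NR) {a : ℝ} (ha : 0 ≤ a) (q : ℕ) :
    seriesCoeff N NR a q ≤ a ^ q / (q.factorial : ℝ) := by
  have h1 : (0 : ℝ) < (ascPochhammer ℝ q).eval (NR : ℝ) :=
    ascPochhammer_pos q _ (by exact_mod_cast hN.trans_le hNR)
  have h2 : (ascPochhammer ℝ q).eval (N : ℝ) ≤ (ascPochhammer ℝ q).eval (NR : ℝ) := by
    rw [ascPochhammer_nat_eq_natCast_ascFactorial, ascPochhammer_nat_eq_natCast_ascFactorial]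
    exact_mod_cast Nat.ascFactorial_le q hNR
  unfold seriesCoeff
  refine mul_le_of_le_one_left (by positivity) ((div_le_one h1).2 h2)

/-- Exponential moments of the density series. -/
theorem integrable_and_hasSum_exp_mul_tsum_pdfTerm (hN : 0 < N) (hNR : N ≤ NR) {a θ s : ℝ}
    (ha : 0 ≤ a) (hθ : 0 < θ) (hs : s < 1 / θ)
    (hsum : ∀ t, Summable (pdfTerm N NR a θ t)) :
    Integrable (fun t => Real.exp (s * t) * ∑' q, pdfTerm N NR a θ t q) ∧
      HasSum (mgfTerm N NR a θ s) (∫ t, Real.exp (s * t) * ∑' q, pdfTerm N NR a θ t q) := by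
  have hσ : 0 < 1 - s * θ := by
    rw [lt_div_iff₀ hθ] at hs; linarith
  have hNR0 : 0 < NR := hN.trans_le hNR
  have hint : ∀ q, Integrable fun t => Real.exp (s * t) * pdfTerm N NR a θ t q := fun q => by
    simp_rw [pdfTerm_eq, mul_left_comm (Real.exp _)]
    exact (integrable_exp_mul_gammaDiff hN hθ hs q).const_mul _
  have hm : ∀ q, Measurable fun t => Real.exp (s * t) * pdfTerm N NR a θ t q := fun q => by
    simp_rw [pdfTerm_eq]
    exact (Measurable.exp (by fun_prop)).mul ((measurable_gammaDiff θ q).const_mul _)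
  have hval : ∀ q, ∫ t, Real.exp (s * t) * pdfTerm N NR a θ t q = mgfTerm N NR a θ s q :=
    fun q => by
    simp_rw [pdfTerm_eq, mul_left_comm (Real.exp _)]
    rw [integral_const_mul, integral_exp_mul_gammaDiff hN hθ hs, mgfTerm]
  -- A_q ≤ a^q/q! against geometric growth: absolute convergence justifies integrating the series
  -- termwise.
  have hnorm : Summable fun q => ∫ t, ‖Real.exp (s * t) * pdfTerm N NR a θ t q‖ := by
    refine Summable.of_nonneg_of_le (fun q => integral_nonneg fun _ => norm_nonneg _) (fun q => ?_)
      ((Real.summable_pow_div_factorial (a * (1 + 1 / (1 - s * θ)))).mul_left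
        (1 / (1 - s * θ) ^ N))
    have h0 := seriesCoeff_nonneg hN hNR0 ha q
    simp_rw [pdfTerm_eq, mul_left_comm (Real.exp _), norm_mul (seriesCoeff N NR a q),
      Real.norm_of_nonneg h0]
    rw [integral_const_mul]
    calc seriesCoeff N NR a q * ∫ t, ‖Real.exp (s * t) * gammaDiff N θ t q‖
        ≤ (a ^ q / (q.factorial : ℝ)) *
          (1 / (1 - s * θ) ^ N * (1 + 1 / (1 - s * θ)) ^ q) :=
          mul_le_mul (seriesCoeff_le hN hNR ha q) (integral_norm_exp_mul_gammaDiff_le hN hθ hs q)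
            (integral_nonneg fun _ => norm_nonneg _) (by positivity)
      _ = _ := by rw [mul_pow]; ring
  simp_rw [← tsum_mul_left]
  refine ⟨integrable_tsum_of_summable_integral_norm hint hm
    (fun t => (hsum t).mul_left _) hnorm, ?_⟩
  have := hasSum_integral_of_summable_integral_norm hint hnorm
  simp_rw [hval] at this
  exact this

end Series

/-! ### The law of the residual for white Gaussian columns. -/

section WhiteLaw

variable {n m d : ℕ}

/-- The law of a Gaussian vector and of `m` independent Gaussian vectors of `ℂⁿ`. -/
noncomputable def gaussianPair (n m : ℕ) :
    Measure (EuclideanSpace ℂ (Fin n) × (Fin m → EuclideanSpace ℂ (Fin n))) :=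
  (halfGaussian (EuclideanSpace ℂ (Fin n))).prod
    (Measure.pi fun _ : Fin m => halfGaussian (EuclideanSpace ℂ (Fin n)))

instance : IsProbabilityMeasure (gaussianPair n m) := by
  unfold gaussianPair; infer_instance

theorem measurable_residualTo_add (k : Fin (m + 1)) (h : EuclideanSpace ℂ (Fin n)) :
    Measurable (fun p : EuclideanSpace ℂ (Fin n) × (Fin m → EuclideanSpace ℂ (Fin n)) =>
      residualTo k (h + p.1) p.2) := by
  have h1 : Measurable (fun p : EuclideanSpace ℂ (Fin n) × (Fin m → EuclideanSpace ℂ (Fin n)) =>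
      (h + p.1, p.2)) := by fun_prop
  exact (measurable_residualTo k).comp h1

/-- Conditionally on the Gaussian family, the residual of a shifted Gaussian vector is a noncentral
chi-square variable. -/
theorem lintegral_exp_residualTo (hd : n = m + d) (k : Fin (m + 1))
    (h : EuclideanSpace ℂ (Fin n)) {σ : ℝ} (hσ : σ < 1) :
    ∫⁻ p, ENNReal.ofReal (Real.exp (σ * residualTo k (h + p.1) p.2)) ∂(gaussianPair n m) =
      ∫⁻ Y, ENNReal.ofReal (1 / (1 - σ) ^ d * Real.exp (σ / (1 - σ) * residualTo k h Y))
        ∂(Measure.pi fun _ : Fin m => halfGaussian (EuclideanSpace ℂ (Fin n))) := by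
  have hm : Measurable (fun p : EuclideanSpace ℂ (Fin n) × (Fin m → EuclideanSpace ℂ (Fin n)) =>
      ENNReal.ofReal (Real.exp (σ * residualTo k (h + p.1) p.2))) :=
    ((measurable_residualTo_add k h).const_mul σ).exp.ennreal_ofReal
  rw [gaussianPair, lintegral_prod_symm _ hm.aemeasurable]
  refine lintegral_congr_ae ?_
  filter_upwards [ae_linearIndependent_pi_halfGaussian (n := n) (m := m) (by omega)] with Y hY
  obtain ⟨T, hTmap, -, hT⟩ := exists_residualTo_eq_norm_sq hd k hY
  simp_rw [hT, map_add]
  rw [show σ / (1 - σ) * ‖T h‖ ^ 2 = σ * ‖T h‖ ^ 2 / (1 - σ) by ring,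
    ← lintegral_exp_norm_sq_complexGaussian hσ, ← hTmap,
    lintegral_map (by fun_prop) T.continuous.measurable]

theorem tsum_pow_div_factorial_mul_pow (l w B : ℝ) :
    ∑' q, l ^ q / (q.factorial : ℝ) * (B * w ^ q) = B * Real.exp (w * l) := by
  have h1 : ∀ q : ℕ, l ^ q / (q.factorial : ℝ) * (B * w ^ q) =
      B * ((w * l) ^ q / (q.factorial : ℝ)) := fun q => by rw [mul_pow]; ring
  simp_rw [h1]
  rw [tsum_mul_left, Real.exp_eq_exp_ℝ, NormedSpace.exp_eq_tsum_div]

/-- Given Y, the transform at σ = sθ is `B exp(wλ)` with w = σ/(1 - σ). Averaging its power series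
in λ over Y replaces λ^q/q! by A_q. -/
theorem mgf_residualTo (hd : n = m + d) (hd0 : 0 < d) (k : Fin (m + 1))
    (h : EuclideanSpace ℂ (Fin n)) {θ s : ℝ} (hθ : 0 < θ) (hs : s < 1 / θ) :
    Integrable (fun p => Real.exp (s * (θ * residualTo k (h + p.1) p.2))) (gaussianPair n m) ∧
      HasSum (mgfTerm d n (‖h‖ ^ 2) θ s)
        (mgf (fun p => θ * residualTo k (h + p.1) p.2) (gaussianPair n m) s) := by
  have hσ : s * θ < 1 := by rwa [lt_div_iff₀ hθ] at hs
  have hσ' : 0 < 1 - s * θ := by linarith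
  set w := s * θ / (1 - s * θ) with hw
  set B := 1 / (1 - s * θ) ^ d with hB
  have hB0 : 0 ≤ B := by positivity
  -- The rate is |w| because w is negative when s < 0.
  have hsum := hasSum_seriesCoeff_mul hd hd0 k h (c := fun q => B * w ^ q) (B := B) (b := |w|)
    (fun q => by rw [abs_mul, abs_pow, abs_of_nonneg hB0])
  simp_rw [tsum_pow_div_factorial_mul_pow] at hsum
  have hint : Integrable (fun Y => B * Real.exp (w * residualTo k h Y))
      (Measure.pi fun _ : Fin m => halfGaussian (EuclideanSpace ℂ (Fin n))) := by
    refine Integrable.of_bound (((measurable_residualTo_left k h).const_mul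
      w).exp.const_mul B).aestronglyMeasurable (B * Real.exp (|w| * ‖h‖ ^ 2)) ?_
    filter_upwards [ae_residualTo_mem_Icc hd k h] with Y hY
    rw [Real.norm_of_nonneg (by positivity)]
    gcongr
    exacts [hY.1, le_abs_self w, hY.2]
  have hl := lintegral_exp_residualTo hd k h hσ
  rw [← hw, ← hB, ← ofReal_integral_eq_lintegral_ofReal hint
    (ae_of_all _ fun _ => by positivity)] at hl
  have hmeas : Measurable (fun p : EuclideanSpace ℂ (Fin n) × (Fin m → EuclideanSpace ℂ (Fin n)) =>
      Real.exp (s * θ * residualTo k (h + p.1) p.2)) :=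
    ((measurable_residualTo_add k h).const_mul _).exp
  simp only [mgf, ← mul_assoc]
  refine ⟨⟨hmeas.aestronglyMeasurable, ?_⟩, ?_⟩
  · rw [hasFiniteIntegral_iff_ofReal (ae_of_all _ fun _ => Real.exp_nonneg _), hl]
    exact ENNReal.ofReal_lt_top
  · rw [integral_eq_lintegral_of_nonneg_ae (ae_of_all _ fun _ => Real.exp_nonneg _)
      hmeas.aestronglyMeasurable, hl, ENNReal.toReal_ofReal
      (integral_nonneg fun _ => by positivity)]
    have : mgfTerm d n (‖h‖ ^ 2) θ s = fun q => seriesCoeff d n (‖h‖ ^ 2) q * (B * w ^ q) :=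
      funext fun q => mgfTerm_eq hσ q
    rw [this]
    exact hsum

/-- The sum is the mean over λ of noncentral chi-square densities, which gives its sign. -/
theorem summable_pdfTerm_and_tsum_nonneg (hd : n = m + d) (hd0 : 0 < d) (k : Fin (m + 1))
    (h : EuclideanSpace ℂ (Fin n)) {θ : ℝ} (hθ : 0 < θ) (t : ℝ) :
    Summable (pdfTerm d n (‖h‖ ^ 2) θ t) ∧ 0 ≤ ∑' q, pdfTerm d n (‖h‖ ^ 2) θ t q := by
  have hsum := hasSum_seriesCoeff_mul hd hd0 k h (c := gammaDiff d θ t) (B := 1 / θ) (b := 2)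
    (abs_gammaDiff_le hd0 hθ t)
  change HasSum (pdfTerm d n (‖h‖ ^ 2) θ t) _ at hsum
  refine ⟨hsum.summable, ?_⟩
  rw [hsum.tsum_eq]
  refine integral_nonneg_of_ae ?_
  filter_upwards [ae_residualTo_mem_Icc hd k h] with Y hY
  exact tsum_pow_mul_gammaDiff_nonneg hd0 hθ t hY.1

/-- Both measures have the transform with series `mgfTerm` for all s < 1/θ. The case s = 0 also
shows that the candidate density has finite mass. -/
theorem map_residualTo_eq_withDensity (hd : n = m + d) (hd0 : 0 < d) (k : Fin (m + 1))
    (h : EuclideanSpace ℂ (Fin n)) {θ : ℝ} (hθ : 0 < θ) :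
    (gaussianPair n m).map (fun p => θ * residualTo k (h + p.1) p.2) =
      volume.withDensity (fun t => ENNReal.ofReal (∑' q, pdfTerm d n (‖h‖ ^ 2) θ t q)) := by
  have hpdf := summable_pdfTerm_and_tsum_nonneg hd hd0 k h hθ
  set f : ℝ → ℝ := fun t => ∑' q, pdfTerm d n (‖h‖ ^ 2) θ t q with hf
  have hf0 : ∀ t, 0 ≤ f t := fun t => (hpdf t).2
  have hfm : Measurable f :=
    measurable_of_tendsto_metrizable
      (fun j => Finset.measurable_sum (Finset.range j) fun q _ =>
        (measurable_gammaDiff (N := d) θ q).const_mul (seriesCoeff d n (‖h‖ ^ 2) q))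
      (tendsto_pi_nhds.2 fun t => by
        simpa only [pdfTerm_eq, Finset.sum_apply, hf] using (hpdf t).1.hasSum.tendsto_sum_nat)
  have hexp : ∀ s < 1 / θ, Integrable (fun t => Real.exp (s * t) * f t) ∧
      HasSum (mgfTerm d n (‖h‖ ^ 2) θ s) (∫ t, Real.exp (s * t) * f t) := fun s hs =>
    integrable_and_hasSum_exp_mul_tsum_pdfTerm hd0 (by omega) (by positivity) hθ hs
      fun t => (hpdf t).1
  have hXm : Measurable (fun p : EuclideanSpace ℂ (Fin n) × (Fin m → EuclideanSpace ℂ (Fin n)) =>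
      θ * residualTo k (h + p.1) p.2) := (measurable_residualTo_add k h).const_mul θ
  have hθ' : 0 < 1 / θ := by positivity
  have : IsFiniteMeasure (volume.withDensity fun t => ENNReal.ofReal (f t)) := by
    refine isFiniteMeasure_withDensity_ofReal ?_
    have := (hexp 0 hθ').1
    simp only [zero_mul, Real.exp_zero, one_mul] at this
    exact this.2
  have : IsFiniteMeasure ((gaussianPair n m).map fun p => θ * residualTo k (h + p.1) p.2) :=
    Measure.isFiniteMeasure_map _ _
  refine measure_ext_of_mgf_eqOn_Iio hθ' (fun s hs => ?_) (fun s hs => ?_) (fun s hs => ?_)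
  · rw [integrable_map_measure (by fun_prop) hXm.aemeasurable]
    exact (mgf_residualTo hd hd0 k h hθ hs).1
  · rw [integrable_withDensity_iff hfm.ennreal_ofReal (by simp)]
    simp_rw [ENNReal.toReal_ofReal (hf0 _)]
    exact (hexp s hs).1
  · rw [mgf_id_map hXm.aemeasurable, mgf, ← mgf.eq_1]
    refine (mgf_residualTo hd hd0 k h hθ hs).2.unique ?_
    rw [mgf, integral_withDensity_eq_integral_toReal_smul hfm.ennreal_ofReal (by simp)]
    simp_rw [ENNReal.toReal_ofReal (hf0 _), id, smul_eq_mul, mul_comm (f _)]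
    exact (hexp s hs).2

end WhiteLaw

/-! ### Whitening and transposition of Gaussian matrices. -/

section Whitening

open scoped MatrixOrder in
theorem Matrix.PosSemidef.exists_eq_conjTranspose_mul_self {n : ℕ} {S : Matrix (Fin n) (Fin n) ℂ}
    (hS : S.PosSemidef) : ∃ B : Matrix (Fin n) (Fin n) ℂ, S = Bᴴ * B := by
  obtain ⟨X, hX, -, hXS⟩ := CFC.exists_sqrt_of_isSelfAdjoint_of_quasispectrumRestricts
    hS.isHermitian (QuasispectrumRestricts.nnreal_of_nonneg hS.nonneg)
  refine ⟨X, ?_⟩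
  rw [← hXS]
  nth_rewrite 1 [← hX.star_eq]
  rfl

/-- A whitening transformation of a covariance matrix that mixes the coordinates other than `k`
among themselves. -/
theorem exists_whitening {n : ℕ} {S : Matrix (Fin n) (Fin n) ℂ} (hS : S.PosDef) (k : Fin n) :
    0 < (S⁻¹ k k).re ∧ ∃ V : Matrix (Fin n) (Fin n) ℂ, IsUnit V.det ∧ Vᴴ * S * V = 1 ∧
      ∀ j, V k j = if j = k then ((Real.sqrt (S⁻¹ k k).re : ℝ) : ℂ) else 0 := by
  have hpos : 0 < (S⁻¹ k k).re := (Complex.pos_iff.1 (hS.inv.diag_pos (i := k))).1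
  refine ⟨hpos, ?_⟩
  obtain ⟨B, hB⟩ := hS.posSemidef.exists_eq_conjTranspose_mul_self
  have hSdet : IsUnit S.det := (isUnit_iff_isUnit_det S).1 hS.isUnit
  have hBdet : IsUnit B.det := by
    rw [hB, det_mul] at hSdet
    exact isUnit_of_mul_isUnit_right hSdet
  set ρ := Real.sqrt (S⁻¹ k k).re with hρ
  have hρ0 : 0 < ρ := Real.sqrt_pos.2 hpos
  have hSinv : S⁻¹ k k = ((∑ m, ‖B⁻¹ k m‖ ^ 2 : ℝ) : ℂ) := by
    rw [hB, Matrix.mul_inv_rev, ← conjTranspose_nonsing_inv, mul_apply]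
    push_cast
    refine Finset.sum_congr rfl fun m _ => ?_
    rw [conjTranspose_apply, ← Complex.mul_conj']
    rfl
  -- Since S⁻¹ = B⁻¹(B⁻¹)ᴴ, row k of B⁻¹ has norm ρ. Taking its normalized conjugate u as column k
  -- of a unitary U makes row k of B⁻¹U equal to ρ⟨u, b j⟩, which vanishes for j ≠ k.
  set u : EuclideanSpace ℂ (Fin n) :=
    WithLp.toLp 2 fun m => ((ρ⁻¹ : ℝ) : ℂ) * star (B⁻¹ k m) with hu
  have hu1 : ‖u‖ = 1 := by
    rw [← sq_eq_sq₀ (norm_nonneg _) zero_le_one, EuclideanSpace.norm_sq_eq]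
    simp only [hu, norm_mul, norm_star, Complex.norm_real, mul_pow, ← Finset.mul_sum]
    have : ∑ m, ‖B⁻¹ k m‖ ^ 2 = ρ ^ 2 := by
      rw [hρ, Real.sq_sqrt hpos.le, hSinv, Complex.ofReal_re]
    rw [this, Real.norm_of_nonneg (by positivity)]
    field_simp
  have ho : Orthonormal ℂ (Set.domRestrict ({k} : Set (Fin n)) fun _ => u) :=
    ⟨fun _ => hu1, fun i j hij => absurd (Subsingleton.elim i j) hij⟩
  obtain ⟨b, hb⟩ := ho.exists_orthonormalBasis_extension_of_card_eq (by simp)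
  have hbk : b k = u := hb k rfl
  set U : Matrix (Fin n) (Fin n) ℂ := Matrix.of fun m l => b l m with hU
  have hUU : Uᴴ * U = 1 := by
    ext i j
    have h1 : inner ℂ (b i) (b j) = (1 : Matrix (Fin n) (Fin n) ℂ) i j := by
      rw [orthonormal_iff_ite.1 b.orthonormal i j, one_apply]
    rw [← h1, PiLp.inner_apply, mul_apply]
    refine Finset.sum_congr rfl fun m _ => ?_
    simp [hU, mul_comm]
  refine ⟨B⁻¹ * U, ?_, ?_, fun j => ?_⟩
  · rw [det_mul]
    refine IsUnit.mul (isUnit_nonsing_inv_det _ hBdet) ?_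
    have : IsUnit (Uᴴ * U).det := by rw [hUU, det_one]; exact isUnit_one
    rw [det_mul] at this
    exact isUnit_of_mul_isUnit_right this
  · have h1 : B * B⁻¹ = 1 := mul_nonsing_inv _ hBdet
    have h2 : B⁻¹ᴴ * Bᴴ = 1 := by rw [← conjTranspose_mul, h1, conjTranspose_one]
    calc (B⁻¹ * U)ᴴ * S * (B⁻¹ * U) = Uᴴ * (B⁻¹ᴴ * Bᴴ) * (B * B⁻¹) * U := by
          rw [hB, conjTranspose_mul]; simp only [Matrix.mul_assoc]
      _ = 1 := by rw [h1, h2, Matrix.mul_one, Matrix.mul_one, hUU]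
  · have h1 : (B⁻¹ * U) k j = (ρ : ℂ) * inner ℂ (b k) (b j) := by
      rw [hbk, PiLp.inner_apply, mul_apply, Finset.mul_sum]
      refine Finset.sum_congr rfl fun m _ => ?_
      have : (ρ : ℂ) ≠ 0 := by exact_mod_cast hρ0.ne'
      simp [hU, hu]
      field_simp
    rw [h1, orthonormal_iff_ite.1 b.orthonormal k j]
    simp [eq_comm]

/-- The conjugated columns of a matrix with independent standard Gaussian rows are independent
standard Gaussian vectors. -/
theorem pi_halfGaussian_map_transpose (p q : ℕ) :
    (Measure.pi fun _ : Fin p => halfGaussian (EuclideanSpace ℂ (Fin q))).map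
      (fun X (j : Fin q) => (WithLp.toLp 2 fun i => star (X i j) : EuclideanSpace ℂ (Fin p))) =
      Measure.pi fun _ : Fin q => halfGaussian (EuclideanSpace ℂ (Fin p)) := by
  set F : (Fin p → EuclideanSpace ℂ (Fin q)) → Fin q → EuclideanSpace ℂ (Fin p) :=
    fun X j => WithLp.toLp 2 fun i => star (X i j) with hF
  have hFm : Measurable F := by
    refine measurable_pi_lambda _ fun j => ?_
    have : Continuous fun X : Fin p → EuclideanSpace ℂ (Fin q) => F X j := by
      simp only [hF]
      fun_prop
    exact this.measurable
  have hto : ∀ μ ν : Measure (Fin q → EuclideanSpace ℂ (Fin p)),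
      μ.map (WithLp.toLp 2) = ν.map (WithLp.toLp 2) → μ = ν := by
    intro μ ν h
    have h2 := congrArg (Measure.map WithLp.ofLp) h
    rw [Measure.map_map (by fun_prop) (by fun_prop), Measure.map_map (by fun_prop) (by fun_prop)]
      at h2
    simpa [Function.comp_def] using h2
  refine hto _ _ (Measure.ext_of_charFun (funext fun t => ?_))
  rw [charFun_pi, Measure.map_map (by fun_prop) hFm]
  -- Conjugate transposition is a real isometry, and the characteristic function depends only on the
  -- norm.
  set t' : PiLp 2 (fun _ : Fin p => EuclideanSpace ℂ (Fin q)) :=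
    WithLp.toLp 2 fun i => WithLp.toLp 2 fun j => star (t j i) with ht'
  have h1 : charFun (((Measure.pi fun _ : Fin p =>
      halfGaussian (EuclideanSpace ℂ (Fin q))).map F).map (WithLp.toLp 2)) t =
      charFun ((Measure.pi fun _ : Fin p =>
        halfGaussian (EuclideanSpace ℂ (Fin q))).map (WithLp.toLp 2)) t' := by
    rw [Measure.map_map (by fun_prop) hFm, charFun_apply, charFun_apply,
      integral_map (Measurable.aemeasurable (by fun_prop)) (by fun_prop),
      integral_map (by fun_prop) (by fun_prop)]
    refine integral_congr_ae (ae_of_all _ fun X => ?_)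
    have : inner ℝ ((WithLp.toLp 2 ∘ F) X : PiLp 2 fun _ : Fin q => EuclideanSpace ℂ (Fin p)) t =
        inner ℝ (WithLp.toLp 2 X : PiLp 2 fun _ : Fin p => EuclideanSpace ℂ (Fin q)) t' := by
      simp only [PiLp.inner_apply, Function.comp_apply, hF, ht']
      rw [Finset.sum_comm]
      refine Finset.sum_congr rfl fun i _ => Finset.sum_congr rfl fun j _ => ?_
      simp [Complex.inner]
    simp only [this]
  rw [← Measure.map_map (by fun_prop) hFm, h1, charFun_pi]
  simp_rw [charFun_halfGaussian, ← Complex.exp_sum]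
  congr 1
  simp only [ht', EuclideanSpace.norm_sq_eq, norm_star]
  rw [← Finset.sum_div, ← Finset.sum_div, Finset.sum_neg_distrib, Finset.sum_neg_distrib]
  push_cast
  rw [Finset.sum_comm]

end Whitening

/-! ### The zero-forcing SNR after whitening. -/

section ZeroForcing

/-- Column `j` of a matrix. -/
noncomputable def colVec {p q : ℕ} (A : Matrix (Fin p) (Fin q) ℂ) (j : Fin q) :
    EuclideanSpace ℂ (Fin p) :=
  WithLp.toLp 2 fun i => A i j

theorem gram_colVec {p q : ℕ} (A : Matrix (Fin p) (Fin q) ℂ) : gram ℂ (colVec A) = Aᴴ * A := by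
  ext i j
  rw [gram_apply, PiLp.inner_apply, mul_apply]
  refine Finset.sum_congr rfl fun m _ => ?_
  simp [colVec, mul_comm]

/-- `(HᴴH)⁻¹ = V ((HV)ᴴ(HV))⁻¹ Vᴴ`, and row k of V has only its k-th entry ρ. The reversal rule for
the total inverse makes this valid for singular `HᴴH` too. -/
theorem zfSNR_eq_residualSq {p q : ℕ} (Γs : ℝ) (H : Matrix (Fin p) (Fin q) ℂ) (k : Fin q)
    {V : Matrix (Fin q) (Fin q) ℂ} (hV : IsUnit V.det) {ρ : ℝ}
    (hVk : ∀ j, V k j = if j = k then (ρ : ℂ) else 0) :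
    zfSNR Γs H k = Γs / ρ ^ 2 * residualSq (colVec (H * V)) k := by
  have hVV : V * V⁻¹ = 1 := mul_nonsing_inv _ hV
  have hVV' : V⁻¹ᴴ * Vᴴ = 1 := by rw [← conjTranspose_mul, hVV, conjTranspose_one]
  have h1 : (Hᴴ * H)⁻¹ = V * (gram ℂ (colVec (H * V)))⁻¹ * Vᴴ := by
    have h2 : gram ℂ (colVec (H * V)) = Vᴴ * ((Hᴴ * H) * V) := by
      rw [gram_colVec, conjTranspose_mul]; simp only [Matrix.mul_assoc]
    rw [h2, Matrix.mul_inv_rev, Matrix.mul_inv_rev, ← conjTranspose_nonsing_inv]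
    calc (Hᴴ * H)⁻¹ = (V * V⁻¹) * (Hᴴ * H)⁻¹ * (V⁻¹ᴴ * Vᴴ) := by
          rw [hVV, hVV', Matrix.one_mul, Matrix.mul_one]
      _ = _ := by simp only [Matrix.mul_assoc]
  have h3 : (Hᴴ * H)⁻¹ k k = ((ρ ^ 2 : ℝ) : ℂ) * (gram ℂ (colVec (H * V)))⁻¹ k k := by
    rw [h1]
    simp only [mul_apply, conjTranspose_apply, hVk]
    rw [Finset.sum_eq_single k (fun j _ hj => by simp [hj]) (by simp)]
    simp
    ring
  rw [zfSNR, h3, Complex.re_ofReal_mul, residualSq]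
  rw [mul_one_div, div_div]

/-- Whitened rows are standard Gaussian. -/
theorem IsComplexGaussian.map_whitened {Ω : Type*} [MeasurableSpace Ω] {P : Measure Ω}
    [IsProbabilityMeasure P] {q : ℕ} {X : Ω → EuclideanSpace ℂ (Fin q)}
    {S V : Matrix (Fin q) (Fin q) ℂ} {c : ℝ} (hX : IsComplexGaussian P X 0 S)
    (hV : Vᴴ * (((c ^ 2 : ℝ) : ℂ) • S) * V = 1) :
    P.map (fun ω => (WithLp.toLp 2 ((c : ℂ) • (Vᴴ *ᵥ (X ω).ofLp)) : EuclideanSpace ℂ (Fin q))) =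
      halfGaussian _ := by
  obtain ⟨hm, hcf⟩ := hX
  set T : EuclideanSpace ℂ (Fin q) → EuclideanSpace ℂ (Fin q) :=
    fun x => WithLp.toLp 2 ((c : ℂ) • (Vᴴ *ᵥ x.ofLp)) with hT
  have hTm : Measurable T := by
    have : Continuous T := by simp only [hT]; fun_prop
    exact this.measurable
  change P.map (T ∘ X) = _
  have : IsProbabilityMeasure (P.map (T ∘ X)) :=
    Measure.isProbabilityMeasure_map (hTm.comp_aemeasurable hm)
  refine halfGaussian_eq_of_charFun fun t => ?_
  -- t' is the adjoint image of t, so the exponent involves t'ᴴSt' = tᴴ(Vᴴ c²S V)t = ‖t‖².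
  set t' : EuclideanSpace ℂ (Fin q) := WithLp.toLp 2 ((c : ℂ) • (V *ᵥ t.ofLp)) with ht'
  have h1 : charFun (P.map (T ∘ X)) t = charFun (P.map X) t' := by
    rw [← AEMeasurable.map_map_of_aemeasurable hTm.aemeasurable hm, charFun_apply,
      integral_map hTm.aemeasurable (by fun_prop), charFun_apply]
    refine integral_congr_ae (ae_of_all _ fun x => ?_)
    have : inner ℝ (T x) t = inner ℝ x t' := by
      rw [EuclideanSpace.inner_real_eq_re_inner, EuclideanSpace.inner_real_eq_re_inner,
        EuclideanSpace.inner_eq_star_dotProduct, EuclideanSpace.inner_eq_star_dotProduct]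
      simp only [hT, ht', star_smul, star_mulVec, conjTranspose_conjTranspose, dotProduct_smul,
        smul_dotProduct]
      rw [dotProduct_comm, ← dotProduct_mulVec, dotProduct_comm (V *ᵥ _)]
      simp
    simp only [this]
  rw [h1, hcf, inner_zero_left]
  congr 1
  have h2 : star t'.ofLp ⬝ᵥ (S *ᵥ t'.ofLp) = ((‖t‖ ^ 2 : ℝ) : ℂ) := by
    have h3 : star t'.ofLp ⬝ᵥ (S *ᵥ t'.ofLp) =
        star t.ofLp ⬝ᵥ ((Vᴴ * (((c ^ 2 : ℝ) : ℂ) • S) * V) *ᵥ t.ofLp) := by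
      have h4 : star t'.ofLp = (c : ℂ) • (star t.ofLp ᵥ* Vᴴ) := by
        rw [ht', WithLp.ofLp_toLp, star_smul, star_mulVec]
        congr 1
        exact Complex.conj_ofReal c
      rw [h4, ht', WithLp.ofLp_toLp, mulVec_smul, smul_dotProduct, dotProduct_smul,
        ← dotProduct_mulVec, Matrix.mul_smul, Matrix.smul_mul, smul_mulVec, dotProduct_smul,
        mulVec_mulVec, mulVec_mulVec, Matrix.mul_assoc, smul_smul]
      push_cast
      rw [pow_two]
    rw [h3, hV, one_mulVec, dotProduct_comm, ← EuclideanSpace.inner_eq_star_dotProduct,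
      inner_self_eq_norm_sq_to_K]
    push_cast
    rfl
  rw [h2]
  push_cast
  ring

end ZeroForcing

/-! ### Assembly and the Rayleigh case. -/

section Main

/-- The zero-forcing SNR is a multiple of the residual of a shifted Gaussian vector with respect to
independent Gaussian vectors. -/
theorem exists_gaussianPair_representation {Ω : Type*} [MeasurableSpace Ω] (P : Measure Ω)
    [IsProbabilityMeasure P] {m NR : ℕ} (k : Fin (m + 1)) {K Γs : ℝ} (hK : 0 ≤ K)
    {RT : Matrix (Fin (m + 1)) (Fin (m + 1)) ℂ} (hS : (transmitCov K RT).PosDef)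
    (Hdn : Matrix (Fin NR) (Fin (m + 1)) ℂ) (Hrn : Ω → Matrix (Fin NR) (Fin (m + 1)) ℂ)
    (hGauss : ∀ i, IsComplexGaussian P (fun ω => conjRow (Hrn ω) i) 0 RT)
    (hIndep : iIndepFun (fun (i : Fin NR) (ω : Ω) => conjRow (Hrn ω) i) P)
    (hRayleigh : ∀ i j, j ≠ k → channelMean K Hdn i j = 0) :
    ∃ (h : EuclideanSpace ℂ (Fin NR))
      (Z : Ω → EuclideanSpace ℂ (Fin NR) × (Fin m → EuclideanSpace ℂ (Fin NR))),
      ‖h‖ ^ 2 = snrMeanParam K RT Hdn k ∧ AEMeasurable Z P ∧ P.map Z = gaussianPair NR m ∧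
      ∀ ω, zfSNR Γs (channel K Hdn (Hrn ω)) k =
        snrScale Γs K RT k * residualTo k (h + (Z ω).1) (Z ω).2 := by
  obtain ⟨hpos, V, hV, hVS, hVk⟩ := exists_whitening hS k
  set r := ((transmitCov K RT)⁻¹ k k).re with hr
  set ρ := Real.sqrt r with hρ
  have hρ2 : ρ ^ 2 = r := Real.sq_sqrt hpos.le
  set c := Real.sqrt (1 / (K + 1)) with hc
  have hc2 : c ^ 2 = 1 / (K + 1) := Real.sq_sqrt (by positivity)
  set T : EuclideanSpace ℂ (Fin (m + 1)) → EuclideanSpace ℂ (Fin (m + 1)) :=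
    fun x => WithLp.toLp 2 ((c : ℂ) • (Vᴴ *ᵥ x.ofLp)) with hT
  have hTm : Measurable T := by
    have : Continuous T := by simp only [hT]; fun_prop
    exact this.measurable
  set X : Fin NR → Ω → EuclideanSpace ℂ (Fin (m + 1)) := fun i => T ∘ fun ω => conjRow (Hrn ω) i
    with hX
  have hXm : ∀ i, AEMeasurable (X i) P := fun i => hTm.comp_aemeasurable (hGauss i).1
  have hXlaw : ∀ i, P.map (X i) = halfGaussian _ := fun i =>
    (hGauss i).map_whitened (c := c) (V := V) (by rw [hc2]; exact hVS)
  have hXind : iIndepFun X P := hIndep.comp (fun _ => T) fun _ => hTm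
  have hXjoint : P.map (fun ω i => X i ω) =
      Measure.pi fun _ : Fin NR => halfGaussian (EuclideanSpace ℂ (Fin (m + 1))) := by
    rw [(iIndepFun_iff_map_fun_eq_pi_map hXm).1 hXind]
    simp_rw [hXlaw]
  -- `conjRow` conjugates; F undoes this and collects columns, giving the columns of the random part
  -- of HV.
  set F : (Fin NR → EuclideanSpace ℂ (Fin (m + 1))) → Fin (m + 1) → EuclideanSpace ℂ (Fin NR) :=
    fun X j => WithLp.toLp 2 fun i => star (X i j) with hF
  have hFm : Measurable F := by
    refine measurable_pi_lambda _ fun j => ?_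
    have : Continuous fun X : Fin NR → EuclideanSpace ℂ (Fin (m + 1)) => F X j := by
      simp only [hF]
      fun_prop
    exact this.measurable
  have hmp := measurePreserving_piFinSuccAbove
    (fun _ : Fin (m + 1) => halfGaussian (EuclideanSpace ℂ (Fin NR))) k
  have hXm' : AEMeasurable (fun ω i => X i ω) P := aemeasurable_pi_lambda _ hXm
  refine ⟨(ρ : ℂ) • colVec (channelMean K Hdn) k,
    fun ω => MeasurableEquiv.piFinSuccAbove (fun _ => EuclideanSpace ℂ (Fin NR)) k
      (F fun i => X i ω), ?_, ?_, ?_, fun ω => ?_⟩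
  · rw [norm_smul, mul_pow, Complex.norm_real, Real.norm_eq_abs, sq_abs, hρ2,
      EuclideanSpace.norm_sq_eq, snrMeanParam]
    rfl
  · exact hmp.measurable.comp_aemeasurable (hFm.comp_aemeasurable hXm')
  · have h1 := AEMeasurable.map_map_of_aemeasurable (μ := P) hFm.aemeasurable hXm'
    rw [hXjoint, pi_halfGaussian_map_transpose] at h1
    have h2 := AEMeasurable.map_map_of_aemeasurable (μ := P) hmp.measurable.aemeasurable
      (hFm.comp_aemeasurable hXm')
    rw [← h1, hmp.map_eq] at h2
    exact h2.symm
  · rw [zfSNR_eq_residualSq Γs _ k hV hVk, hρ2, snrScale, residualTo]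
    congr 2
    -- Only column k of the mean survives, so the mean of HV is that column times row k of V; it
    -- sits entirely in column k, scaled by ρ.
    have hent : ∀ i j, (channel K Hdn (Hrn ω) * V) i j =
        channelMean K Hdn i k * V k j + F (fun i => X i ω) j i := by
      intro i j
      rw [channel, Matrix.add_mul, Matrix.add_apply, mul_apply,
        Finset.sum_eq_single k (fun l _ hl => by rw [hRayleigh i l hl, zero_mul]) (by simp),
        Matrix.smul_mul, Matrix.smul_apply, smul_eq_mul, mul_apply]
      congr 1
      simp only [hF, hX, hT, Function.comp_apply, conjRow, mulVec, dotProduct, Pi.smul_apply,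
        smul_eq_mul, star_mul', star_sum,
        conjTranspose_apply, star_star]
      have : star (c : ℂ) = c := Complex.conj_ofReal c
      rw [this]
      congr 1
      exact Finset.sum_congr rfl fun l _ => mul_comm _ _
    ext j i
    rcases Fin.eq_self_or_eq_succAbove k j with rfl | ⟨l, rfl⟩
    · simp [colVec, hent, hVk, MeasurableEquiv.piFinSuccAbove, mul_comm]
      rfl
    · simp [colVec, hent, hVk, MeasurableEquiv.piFinSuccAbove, Fin.succAbove_ne]
      rfl

theorem transmitCov_inv {q : ℕ} {K : ℝ} (hK : 0 ≤ K) {RT : Matrix (Fin q) (Fin q) ℂ}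
    (hRT : IsUnit RT.det) : (transmitCov K RT)⁻¹ = ((K + 1 : ℝ) : ℂ) • RT⁻¹ := by
  refine inv_eq_left_inv ?_
  rw [transmitCov, Matrix.smul_mul, Matrix.mul_smul, smul_smul, nonsing_inv_mul _ hRT,
    ← Complex.ofReal_mul, mul_one_div_cancel (by positivity), Complex.ofReal_one, one_smul]

theorem transmitCov_posDef {q : ℕ} {K : ℝ} (hK : 0 ≤ K) {RT : Matrix (Fin q) (Fin q) ℂ}
    (hRT : RT.PosDef) : (transmitCov K RT).PosDef := by
  refine hRT.smul ?_
  rw [Complex.zero_lt_real]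
  positivity

/-- Column k carries the whole Frobenius norm of the mean. -/
theorem sum_norm_sq_channelMean {NR NT : ℕ} {K : ℝ} (hK : 0 ≤ K)
    (Hdn : Matrix (Fin NR) (Fin NT) ℂ) (k : Fin NT)
    (hHdn : ∑ i, ∑ j, ‖Hdn i j‖ ^ 2 = (NT : ℝ) * (NR : ℝ))
    (hRayleigh : ∀ i j, j ≠ k → channelMean K Hdn i j = 0) :
    ∑ i, ‖channelMean K Hdn i k‖ ^ 2 = K / (K + 1) * (NT * NR) := by
  have h1 : ∀ i, ‖channelMean K Hdn i k‖ ^ 2 = ∑ j, ‖channelMean K Hdn i j‖ ^ 2 := fun i => by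
    rw [Finset.sum_eq_single k (fun j _ hj => by simp [hRayleigh i j hj]) (by simp)]
  have h2 : ∀ i j, ‖channelMean K Hdn i j‖ ^ 2 = K / (K + 1) * ‖Hdn i j‖ ^ 2 := fun i j => by
    rw [channelMean, Matrix.smul_apply, norm_smul, mul_pow, Complex.norm_real, Real.norm_eq_abs,
      sq_abs, Real.sq_sqrt (by positivity)]
  simp_rw [h1, h2, ← Finset.mul_sum]
  rw [hHdn]

theorem seriesCoeff_zero_right {N NR : ℕ} (q : ℕ) :
    seriesCoeff N NR 0 q = if q = 0 then 1 else 0 := by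
  rcases q with _ | q <;> simp [seriesCoeff]

theorem tsum_pdfTerm_zero {N NR : ℕ} (θ t : ℝ) :
    ∑' q, pdfTerm N NR 0 θ t q = gammaPDFReal (N : ℝ) (1 / θ) t := by
  rw [tsum_eq_single 0 fun q hq => by simp [pdfTerm, seriesCoeff_zero_right, hq]]
  simp [pdfTerm, seriesCoeff_zero_right]

theorem tsum_mgfTerm_zero {N NR : ℕ} (θ s : ℝ) :
    ∑' q, mgfTerm N NR 0 θ s q = 1 / (1 - s * θ) ^ N := by
  rw [tsum_eq_single 0 fun q hq => by simp [mgfTerm, seriesCoeff_zero_right, hq]]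
  simp [mgfTerm, seriesCoeff_zero_right]

end Main

theorem mainTheorem2 {Ω : Type*} [MeasurableSpace Ω] (P : Measure Ω) [IsProbabilityMeasure P]
    (NT NR N : ℕ) (hTR : NT ≤ NR) (hN : N = NR - NT + 1) (k : Fin NT)
    (K Γs : ℝ) (hK : 0 ≤ K) (hΓs : 0 < Γs)
    (RT : Matrix (Fin NT) (Fin NT) ℂ) (hRT : RT.PosDef) (hRTdiag : ∀ j, RT j j = 1)
    (Hdn : Matrix (Fin NR) (Fin NT) ℂ)
    (hHdn : ∑ i, ∑ j, ‖Hdn i j‖ ^ 2 = (NT : ℝ) * (NR : ℝ))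
    (Hrn : Ω → Matrix (Fin NR) (Fin NT) ℂ)
    (hGauss : ∀ i, IsComplexGaussian P (fun ω => conjRow (Hrn ω) i) 0 RT)
    (hIndep : iIndepFun (fun (i : Fin NR) (ω : Ω) => conjRow (Hrn ω) i) P)
    -- all streams other than the intended stream `k` undergo Rayleigh fading
    (hRayleigh : ∀ i j, j ≠ k → channelMean K Hdn i j = 0)
    (γ : Ω → ℝ) (hγ : γ = fun ω => zfSNR Γs (channel K Hdn (Hrn ω)) k)
    (Γ a : ℝ) (hΓ : Γ = snrScale Γs K RT k) (ha : a = snrMeanParam K RT Hdn k) :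
    -- the parameters
    (0 < Γ ∧ Γ = Γs / ((K + 1) * (RT⁻¹ k k).re) ∧
      a = K * (NR : ℝ) * (NT : ℝ) * (RT⁻¹ k k).re) ∧
    -- the series for the moment generating function
    (∀ s : ℝ, s < 1 / Γ →
      Integrable (fun ω => Real.exp (s * γ ω)) P ∧
      HasSum (mgfTerm N NR a Γ s) (mgf γ P s)) ∧
    -- the series for the density
    AEMeasurable γ P ∧
    (∀ t : ℝ, Summable (pdfTerm N NR a Γ t) ∧ 0 ≤ ∑' n, pdfTerm N NR a Γ t n) ∧
    P.map γ = volume.withDensity (fun t => ENNReal.ofReal (∑' n, pdfTerm N NR a Γ t n)) ∧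
    -- the Rayleigh case
    (K = 0 → a = 0) ∧
    (a = 0 →
      (∀ s : ℝ, s < 1 / Γ → mgf γ P s = 1 / (1 - s * Γ) ^ N) ∧
      (∀ t : ℝ, ∑' n, pdfTerm N NR a Γ t n = gammaPDFReal (N : ℝ) (1 / Γ) t) ∧
      P.map γ = gammaMeasure (N : ℝ) (1 / Γ)) := by
  -- The stream k forces NT > 0; m counts the interfering streams, and N = NR - m is the dimension
  -- left after projecting them out.
  obtain ⟨m, rfl⟩ : ∃ m, NT = m + 1 := ⟨NT - 1, by have := k.pos; omega⟩
  have hd : NR = m + N := by omega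
  have hN0 : 0 < N := by omega
  have hRTdet : IsUnit RT.det := (isUnit_iff_isUnit_det RT).1 hRT.isUnit
  have hS := transmitCov_posDef hK hRT
  have hinv : ((transmitCov K RT)⁻¹ k k).re = (K + 1) * (RT⁻¹ k k).re := by
    rw [transmitCov_inv hK hRTdet, Matrix.smul_apply, smul_eq_mul, Complex.re_ofReal_mul]
  have hpos : 0 < ((transmitCov K RT)⁻¹ k k).re := (exists_whitening hS k).1
  have hΓ0 : 0 < Γ := by rw [hΓ, snrScale]; positivity
  have haK : a = K * (NR : ℝ) * ((m + 1 : ℕ) : ℝ) * (RT⁻¹ k k).re := by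
    rw [ha, snrMeanParam, hinv, sum_norm_sq_channelMean hK Hdn k hHdn hRayleigh]
    field_simp
  obtain ⟨h, Z, hh, hZm, hZ, hγZ⟩ := exists_gaussianPair_representation (Γs := Γs) P k hK hS Hdn
    Hrn hGauss hIndep hRayleigh
  rw [← ha] at hh
  subst hh
  set Φ : EuclideanSpace ℂ (Fin NR) × (Fin m → EuclideanSpace ℂ (Fin NR)) → ℝ :=
    fun p => Γ * residualTo k (h + p.1) p.2 with hΦ
  have hΦm : Measurable Φ := (measurable_residualTo_add k h).const_mul Γ
  have hγΦ : γ = Φ ∘ Z := by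
    rw [hγ]
    funext ω
    rw [hγZ ω, ← hΓ]
    rfl
  have hγm : AEMeasurable γ P := hγΦ ▸ hΦm.comp_aemeasurable hZm
  have hexp : ∀ s : ℝ, Measurable fun p => Real.exp (s * Φ p) := fun s => (hΦm.const_mul s).exp
  have hmgf : ∀ s : ℝ, s < 1 / Γ → Integrable (fun ω => Real.exp (s * γ ω)) P ∧
      HasSum (mgfTerm N NR (‖h‖ ^ 2) Γ s) (mgf γ P s) := by
    intro s hs
    obtain ⟨h1, h2⟩ := mgf_residualTo hd hN0 k h hΓ0 hs
    rw [← hZ, mgf_map hZm (hexp s).aestronglyMeasurable] at h2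
    rw [← hZ, integrable_map_measure (hexp s).aestronglyMeasurable hZm] at h1
    rw [hγΦ]
    exact ⟨h1, h2⟩
  have hlaw : P.map γ =
      volume.withDensity (fun t => ENNReal.ofReal (∑' n, pdfTerm N NR (‖h‖ ^ 2) Γ t n)) := by
    rw [← map_residualTo_eq_withDensity hd hN0 k h hΓ0, ← hZ, hγΦ,
      AEMeasurable.map_map_of_aemeasurable hΦm.aemeasurable hZm]
  refine ⟨⟨hΓ0, by rw [hΓ, snrScale, hinv], haK⟩, hmgf, hγm,
    summable_pdfTerm_and_tsum_nonneg hd hN0 k h hΓ0, hlaw, ?_, fun ha0 => ⟨?_, ?_, ?_⟩⟩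
  · rintro rfl
    rw [haK]
    ring
  · intro s hs
    rw [← (hmgf s hs).2.tsum_eq, ha0, tsum_mgfTerm_zero]
  · intro t
    rw [ha0, tsum_pdfTerm_zero]
  · rw [hlaw, ha0]
    simp_rw [tsum_pdfTerm_zero]
    rfl
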